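/- **Definitions.** A standard polysymplectic basis for alternating forms $\omega_1,\dots,\omega_s\in\Lambda^2V^*$ on a vector space $V$ of dimension $n(s+1)$ is a basis $v_1,\dots,v_n,w^1_1,\dots,w^s_n$ of $V$ such that $\omega_j=\sum_{i=1}^n v_i^*\wedge (w_i^j)^*$ for all $j$. A manifold of dimension $n(s+1)$ with smooth closed $2$-forms $\omega_1,\dots,\omega_s$ is *polysymplectic* if each tangent space has a standard polysymplectic basis and the distribution $\sum_j\omega_j^\perp$ is integrable, where $\omega_j^\perp$ is the space of vectors contracting to zero with $\omega_j$. A Riemannian metric is *compatible* with it if each tangent space has an orthonormal standard polysymplectic basis; the manifold with such a metric is called *almost $s$-Kähler*. A smooth submersion $f:(X,g)\to B$ is *Riemannian* with respect to a metric $h$ on $B$ if $df_p:(\ker df_p)^\perp\to T_{f(p)}B$ is an isometry for all $p$. It is *covariant constant* if moreover $df$ intertwines parallel transport along every path $\gamma$ in $X$ with parallel transport along $f\circ\gamma$ in $B$ (Levi-Civita connections of $g$ and $h$). **Theorem.** Let $n\ge 0$, $s\ge 1$. Let $(X_i,\omega_{X_i},g_{X_i})$, $i=1,\dots,s$, be almost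 Kähler manifolds of real dimension $2n$ (that is, $\omega_{X_i}$ is symplectic and $g_{X_i}(u,v)=\omega_{X_i}(u,J_iv)$ for an almost complex structure $J_i$). Let $B$ be a smooth manifold of dimension $n$, and let $f_i:X_i\to B$ be surjective smooth submersions whose fibres are Lagrangian for $\omega_{X_i}$. Then the fibre product $X=X_1\times_B\cdots\times_BX_s$ is an embedded smooth submanifold of $X_1\times\cdots\times X_s$ of dimension $n(s+1)$. Let $\pi_i:X\to X_i$ be the projections, let $g$ be the Riemannian metric on $X$ induced from the product metric, $g(u,v)=\sum_i g_{X_i}(d\pi_i u,d\pi_i v)$, and let $\omega_j=\sqrt{s}\,\pi_j^*\omega_{X_j}$. Then: 1. $(X,\omega_1,\dots,\omega_s)$ is a polysymplectic manifold. 2. If all the $f_i$ are Riemannian with respect to one and the same Riemannian metric on $B$, then $g$ is compatible with the polysymplectic structure; that is, $(X,\omega_1,\dots,\omega_s,g)$ is an almost $s$-Kähler manifold. 3. If, in addition to the hypothesis of 2, every $\omega_{X_i}$ is parallel for the Levi-Civita connection of $g_{X_i}$ and every $f_i$ is covariant constant, then every $\omega_j$ is parallel for the Levi-Civita connection of $g$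 on $X$. -/

import Mathlib

open scoped Manifold ContDiff Bundle Topology

noncomputable section

namespace PolyK

/-- The model space `ℝᵐ`; all manifolds below are smooth, without boundary, modelled on some `𝓡 m`. -/
abbrev Model (m : ℕ) : Type := EuclideanSpace ℝ (Fin m)

section Manifolds

variable {m : ℕ} {M : Type*} [TopologicalSpace M] [ChartedSpace (Model m) M]

variable (m M) in
/-- A (not necessarily continuous) field of alternating `k`-forms on the tangent spaces of `M`. -/
abbrev FormField (k : ℕ) : Type _ := ∀ x : M, (TangentSpace (𝓡 m) x) [⋀^Fin k]→L[ℝ] ℝ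

variable (m M) in
/-- A smooth Riemannian metric on `M`. -/
abbrev Metric [IsManifold (𝓡 m) 1 M] : Type _ :=
  Bundle.ContMDiffRiemannianMetric (𝓡 m) ∞ (Model m) (fun x : M ↦ TangentSpace (𝓡 m) x)

variable (m) in
/-- The differential at `y` of the inverse of the chart around `c`; its columns are the coordinate
vector fields of that chart. -/
def chartFrame (c : M) (y : Model m) :
    Model m →L[ℝ] TangentSpace (𝓡 m) ((extChartAt (𝓡 m) c).symm y) :=
  mfderiv 𝓘(ℝ, Model m) (𝓡 m) (extChartAt (𝓡 m) c).symm y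

/-- The coordinate expression of a field of forms in the chart around `c`. -/
def FormField.inChart {k : ℕ} (η : FormField m M k) (c : M) (y : Model m) :
    (Model m) [⋀^Fin k]→L[ℝ] ℝ :=
  (η ((extChartAt (𝓡 m) c).symm y)).compContinuousLinearMap (chartFrame m c y)

/-- `η` is a smooth differential form: its coordinate expressions are smooth. -/
def FormField.IsSmooth {k : ℕ} (η : FormField m M k) : Prop :=
  ∀ c : M, ContDiffOn ℝ ∞ (η.inChart c) (extChartAt (𝓡 m) c).target

/-- `dη = 0`, the exterior derivative being computed in charts. -/
def FormField.IsClosed {k : ℕ} (η : FormField m M k) : Prop :=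
  ∀ c : M, ∀ y ∈ (extChartAt (𝓡 m) c).target, extDeriv (η.inChart c) y = 0

/-- The pull-back of a field of forms along a map. -/
def FormField.pullback {k l : ℕ} {N : Type*} [TopologicalSpace N] [ChartedSpace (Model l) N]
    (φ : M → N) (η : FormField l N k) : FormField m M k :=
  fun x ↦ (η (φ x)).compContinuousLinearMap (mfderiv (𝓡 m) (𝓡 l) φ x)

/-- The space `η^⊥` of the vectors at `x` which contract to zero with `η`. -/
def FormField.perp (η : FormField m M 2) (x : M) : Submodule ℝ (TangentSpace (𝓡 m) x) where
  carrier := {u | ∀ v, η x ![u, v] = 0}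
  zero_mem' v := (η x).map_coord_zero 0 rfl
  add_mem' {u u'} hu hu' v := by
    have h := (η x).toMultilinearMap.cons_add ![v] u u'
    have h1 := hu v
    have h2 := hu' v
    change η x ![u + u', v] = η x ![u, v] + η x ![u', v] at h
    rw [h, h1, h2, add_zero]
  smul_mem' r u hu v := by
    have h := (η x).toMultilinearMap.cons_smul ![v] r u
    have h1 := hu v
    change η x ![r • u, v] = r • η x ![u, v] at h
    rw [h, h1, smul_zero]

/-- The field of subspaces `D` is an integrable distribution: locally it is tangent to the common
level sets of finitely many smooth functions with independent differentials. -/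
def IsIntegrable (D : ∀ x : M, Submodule ℝ (TangentSpace (𝓡 m) x)) : Prop :=
  ∀ p : M, ∃ U : Set M, IsOpen U ∧ p ∈ U ∧ ∃ (r : ℕ) (h : M → Model r),
    ContMDiffOn (𝓡 m) (𝓡 r) ∞ h U ∧
    ∀ q ∈ U, Function.Surjective (mfderiv (𝓡 m) (𝓡 r) h q) ∧
      D q = LinearMap.ker (mfderiv (𝓡 m) (𝓡 r) h q).toLinearMap

end Manifolds

/-! ### Polysymplectic structures -/

/-- `b = (v₁, …, vₙ, w¹₁, …, wˢₙ)`, with `vᵢ = b (inl i)` and `wʲᵢ = b (inr (j, i))`, is a standard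
polysymplectic basis for `η₁, …, ηₛ`, i.e. `ηⱼ = ∑ᵢ vᵢ* ∧ (wʲᵢ)*` for all `j`. -/
def IsStandardBasis {n s : ℕ} {V : Type*} [AddCommGroup V] [Module ℝ V] [TopologicalSpace V]
    (η : Fin s → V [⋀^Fin 2]→L[ℝ] ℝ) (b : Module.Basis (Fin n ⊕ Fin s × Fin n) ℝ V) : Prop :=
  ∀ (j : Fin s) (x y : V), η j ![x, y] =
    ∑ i : Fin n, (b.coord (.inl i) x * b.coord (.inr (j, i)) y
      - b.coord (.inl i) y * b.coord (.inr (j, i)) x)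

section Structures

variable {m : ℕ} {M : Type*} [TopologicalSpace M] [ChartedSpace (Model m) M]

/-- `(M, η₁, …, ηₛ)` is a polysymplectic manifold (of dimension `n (s + 1)`). -/
structure IsPolysymplectic (n : ℕ) {s : ℕ} (η : Fin s → FormField m M 2) : Prop where
  smooth : ∀ j, (η j).IsSmooth
  closed : ∀ j, (η j).IsClosed
  pointwise : ∀ p : M, ∃ b : Module.Basis (Fin n ⊕ Fin s × Fin n) ℝ (TangentSpace (𝓡 m) p),
    IsStandardBasis (fun j ↦ η j p) b
  integrable : IsIntegrable (fun p ↦ ⨆ j, (η j).perp p)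

variable [IsManifold (𝓡 m) 1 M]

/-- The metric `g` is compatible with the polysymplectic structure: at every point there is a
standard polysymplectic basis which is orthonormal for `g`. -/
def IsCompatible (n : ℕ) {s : ℕ} (g : Metric m M) (η : Fin s → FormField m M 2) : Prop :=
  ∀ p : M, ∃ b : Module.Basis (Fin n ⊕ Fin s × Fin n) ℝ (TangentSpace (𝓡 m) p),
    IsStandardBasis (fun j ↦ η j p) b ∧ ∀ a a', g.inner p (b a) (b a') = if a = a' then 1 else 0

/-- `(M, η₁, …, ηₛ, g)` is an almost `s`-Kähler manifold. -/
def IsAlmostSKahler (n : ℕ) {s : ℕ} (g : Metric m M) (η : Fin s → FormField m M 2) : Prop :=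
  IsPolysymplectic n η ∧ IsCompatible n g η

/-- `(M, η, g)` is an almost Kähler manifold: `η` is a closed `2`-form and
`g(u, v) = η(u, J v)` for an almost complex structure `J` (so that `η` is symplectic). -/
structure IsAlmostKahler (g : Metric m M) (η : FormField m M 2) : Prop where
  smooth : η.IsSmooth
  closed : η.IsClosed
  compatible : ∀ x : M, ∃ J : TangentSpace (𝓡 m) x →L[ℝ] TangentSpace (𝓡 m) x,
    (∀ v, J (J v) = -v) ∧ ∀ u v, g.inner x u v = η x ![u, J v]

/-! ### The Levi-Civita connection -/

/-- The coordinate expression of the metric in the chart around `c`. -/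
def metricInChart (g : Metric m M) (c : M) (y : Model m) : Model m →L[ℝ] Model m →L[ℝ] ℝ :=
  (ContinuousLinearMap.precomp ℝ (chartFrame m c y)).comp
    ((g.inner ((extChartAt (𝓡 m) c).symm y)).comp (chartFrame m c y))

/-- The Christoffel symbol `Γ(u, v)` of the Levi-Civita connection at the point `y` of the chart
around `c`: with `G` the metric in that chart,
`G(Γ(u, v), w) = (∂ᵤG(v, w) + ∂ᵥG(u, w) - ∂_wG(u, v)) / 2` for all `w`. -/
def christoffel (g : Metric m M) (c : M) (y u v : Model m) : Model m :=
  let G := metricInChart g c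
  let DG := fderiv ℝ G y
  (G y).inverse ((1 / 2 : ℝ) • (DG u v + DG v u - (DG.flip u).flip v))

/-- `∇η = 0` for the Levi-Civita connection of `g`, that is
`∂ᵤ(η(v, w)) - η(Γ(u, v), w) - η(v, Γ(u, w)) = 0` in charts, for constant `u, v, w`. -/
def IsParallelForm (g : Metric m M) (η : FormField m M 2) : Prop :=
  ∀ c : M, ∀ y ∈ (extChartAt (𝓡 m) c).target, ∀ u v w : Model m,
    fderiv ℝ (η.inChart c) y u ![v, w] - η.inChart c y ![christoffel g c y u v, w]
      - η.inChart c y ![v, christoffel g c y u w] = 0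

/-- The vector field `V` along the curve `γ`, `t ∈ [0, 1]`, is parallel:
`V' + Γ(γ', V) = 0` in every chart. -/
def IsParallelAlong (g : Metric m M) (γ : ℝ → M) (V : ∀ t, TangentSpace (𝓡 m) (γ t)) : Prop :=
  ∀ t ∈ Set.Icc (0 : ℝ) 1, ∀ c : M, γ t ∈ (extChartAt (𝓡 m) c).source →
    let y : ℝ → Model m := fun τ ↦ extChartAt (𝓡 m) c (γ τ)
    let ξ : ℝ → Model m := fun τ ↦ mfderiv (𝓡 m) 𝓘(ℝ, Model m) (extChartAt (𝓡 m) c) (γ τ) (V τ)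
    HasDerivWithinAt ξ (-christoffel g c (y t) (derivWithin y (Set.Icc 0 1) t) (ξ t))
      (Set.Icc 0 1) t

/-- `v₁ = G(v₀)`, where `G : T_{γ(0)}M → T_{γ(1)}M` is the parallel transport along `γ`. -/
def IsParallelTransport (g : Metric m M) (γ : ℝ → M) (v₀ : TangentSpace (𝓡 m) (γ 0))
    (v₁ : TangentSpace (𝓡 m) (γ 1)) : Prop :=
  ∃ V : ∀ t, TangentSpace (𝓡 m) (γ t), IsParallelAlong g γ V ∧ V 0 = v₀ ∧ V 1 = v₁

/-! ### Fibrations -/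

variable {n : ℕ} {B : Type*} [TopologicalSpace B] [ChartedSpace (Model n) B]

variable (n) in
/-- `f` is a surjective smooth submersion whose fibres are Lagrangian for `η`: the tangent space
`ker df` of the fibre is its own `η`-orthogonal. -/
structure IsLagrangianFibration (η : FormField m M 2) (f : M → B) : Prop where
  surjective : Function.Surjective f
  submersion : Manifold.IsSubmersion (𝓡 m) (𝓡 n) ∞ f
  lagrangian : ∀ (x : M) (u : TangentSpace (𝓡 m) x), mfderiv (𝓡 m) (𝓡 n) f x u = 0 ↔
    ∀ v : TangentSpace (𝓡 m) x, mfderiv (𝓡 m) (𝓡 n) f x v = 0 → η x ![u, v] = 0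

variable [IsManifold (𝓡 n) 1 B]

/-- The submersion `f` is Riemannian with respect to the metric `h` on the base: `df` is isometric
on the orthogonal complement of `ker df`. -/
def IsRiemannian (g : Metric m M) (h : Metric n B) (f : M → B) : Prop :=
  ∀ (x : M) (u v : TangentSpace (𝓡 m) x),
    (∀ w, mfderiv (𝓡 m) (𝓡 n) f x w = 0 → g.inner x u w = 0) →
    (∀ w, mfderiv (𝓡 m) (𝓡 n) f x w = 0 → g.inner x v w = 0) →
    h.inner (f x) (mfderiv (𝓡 m) (𝓡 n) f x u) (mfderiv (𝓡 m) (𝓡 n) f x v) = g.inner x u v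

/-- The submersion `f` is covariant constant: it is Riemannian and `df` commutes with the parallel
transports along `γ` and `f ∘ γ`, for every path `γ`. -/
def IsCovariantConstant (g : Metric m M) (h : Metric n B) (f : M → B) : Prop :=
  IsRiemannian g h f ∧
  ∀ γ : ℝ → M, ContMDiffOn 𝓘(ℝ, ℝ) (𝓡 m) ∞ γ (Set.Icc 0 1) → ∀ v₀ v₁,
    IsParallelTransport g γ v₀ v₁ →
    IsParallelTransport h (f ∘ γ) (mfderiv (𝓡 m) (𝓡 n) f (γ 0) v₀)
      (mfderiv (𝓡 m) (𝓡 n) f (γ 1) v₁)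

end Structures

/-! ### Fibre products -/

/-- The fibre product `X₁ ×_B ⋯ ×_B Xₛ`, with its topology as a subspace of `X₁ × ⋯ × Xₛ`. -/
abbrev FibreProduct {s : ℕ} {X : Fin s → Type*} {B : Type*} (f : ∀ i, X i → B) : Type _ :=
  {p : ∀ i, X i // ∀ i j, f i (p i) = f j (p j)}

/-- The projection of the fibre product to its `i`-th factor. -/
def FibreProduct.proj {s : ℕ} {X : Fin s → Type*} {B : Type*} (f : ∀ i, X i → B) (i : Fin s) :
    FibreProduct f → X i :=
  fun p ↦ p.1 i

/-- The given charts (with values in `ℝᵈ`) make the fibre product an embedded smooth submanifold of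
`X₁ × ⋯ × Xₛ`. The topology is the subspace topology, so this says that the inclusion
`p ↦ (π₁ p, …, πₛ p)` is smooth with injective differential. -/
structure IsSubmanifold {s k d : ℕ} {X : Fin s → Type*} [∀ i, TopologicalSpace (X i)]
    [∀ i, ChartedSpace (Model k) (X i)] {B : Type*} (f : ∀ i, X i → B)
    [ChartedSpace (Model d) (FibreProduct f)] : Prop where
  smooth : ∀ i, ContMDiff (𝓡 d) (𝓡 k) ∞ (FibreProduct.proj f i)
  immersive : ∀ (p : FibreProduct f) (u : TangentSpace (𝓡 d) p),
    (∀ i, mfderiv (𝓡 d) (𝓡 k) (FibreProduct.proj f i) p u = 0) → u = 0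

end PolyK

end

open PolyK

noncomputable section

set_option linter.unusedSectionVars false
set_option maxSynthPendingDepth 3

/-! Near a point, choose one chart of $B$ and charts of the $X_i$ in which every $f_i$ is the
projection to that chart. The base coordinates together with the $s$ families of fibre coordinates
are then a chart of $X$. By a dimension count, $T_pX$ is the space of all families $(u_i)$ whose
images $df_i(u_i)$ agree (`exists_common_lift`).

The polysymplectic structure is linear algebra plus one remark about kernels. In $T X_i$ the space
$J_i(\ker df_i)$ is a Lagrangian complement of $\ker df_i$. So a basis $e_k$ of $TB$ lifts to
horizontal vectors $v^i_k$ with a dual vertical family $w^i_l$ (`exists_adapted_family`). In $T_pX$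
take $x_k = s^{-1/2}(v^1_k,\dots,v^s_k)$, and let $z^j_l$ have the single entry $w^j_l$ in slot $j$.
The factor $\sqrt s$ in $\omega_j$ makes the pairings of $x_k$ and $z^j_l$ equal to $1$ or $0$. If
the $f_i$ are Riemannian and $e$ is orthonormal, then each $v^i$ and each $w^i$ is orthonormal, and
$s$ summands of size $1/s$ make $x_k$ a unit vector. Moreover $\omega_j^\perp = \ker d\pi_j$. The
sum of these kernels is the kernel of the differential of $X \to B$ if $s \ge 2$ and is zero if $s =
1$. Both are kernels of submersions, hence integrable.

For parallelism it suffices that each $\pi_i$ has vanishing second fundamental form, since a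
parallel form then pulls back to a parallel form (`IsParallelForm.smul_pullback`). Up to sign this
tensor is `christoffelDefect`. Let $S_i$ be its value for $\pi_i$ at fixed $u, v$. The Koszul
formula shows that $(S_i)$ is orthogonal to $TX$ in the product metric
(`sum_metric_christoffelDefect`). A covariant constant $f_i$ has vanishing second fundamental form
(`christoffelDefect_of_isCovariantConstant`), so the chain rule makes $df_i(S_i)$ the tensor of $X
\to B$, which does not depend on $i$. Hence $(S_i)$ is also tangent to $X$, and so it is zero
(`christoffelDefect_fibreProduct`). -/

namespace PolyK


/-! ### Smooth families of alternating maps. -/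

section AlternatingMap

variable {E : Type*} [NormedAddCommGroup E] [NormedSpace ℝ E] {m k : ℕ}

/-- A family of alternating maps on `ℝᵐ` is smooth when all its values are. -/
theorem contDiffAt_continuousAlternatingMap {Φ : E → (Model m) [⋀^Fin k]→L[ℝ] ℝ} {x : E}
    (h : ∀ v, ContDiffAt ℝ ∞ (fun z ↦ Φ z v) x) : ContDiffAt ℝ ∞ Φ x := by
  let b := (EuclideanSpace.basisFun (Fin m) ℝ).toBasis
  let ev : ((Model m) [⋀^Fin k]→L[ℝ] ℝ) →ₗ[ℝ] ((Fin k → Fin m) → ℝ) :=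
    { toFun := fun f a ↦ f fun i ↦ b (a i)
      map_add' := fun f f' ↦ rfl
      map_smul' := fun r f ↦ rfl }
  have hev : LinearMap.ker ev = ⊥ := by
    rw [LinearMap.ker_eq_bot]
    intro f f' hff
    apply ContinuousAlternatingMap.toAlternatingMap_injective
    exact Module.Basis.ext_alternating b fun v _ ↦ congrFun hff v
  -- Evaluation on tuples of basis vectors embeds the alternating maps in a finite-dimensional
  -- space. A linear retraction of that space is continuous, so smoothness of finitely many values
  -- suffices.
  obtain ⟨r, hr⟩ := ev.exists_leftInverse_of_injective hev
  have h1 : Φ = fun z ↦ LinearMap.toContinuousLinearMap r (ev (Φ z)) := by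
    ext1 z
    exact (DFunLike.congr_fun hr (Φ z)).symm
  rw [h1]
  refine (ContinuousLinearMap.contDiff _).contDiffAt.comp x ?_
  exact contDiffAt_pi.2 fun a ↦ h _

theorem _root_.ContDiffAt.continuousAlternatingMap_compContinuousLinearMap {l : ℕ}
    {η : E → (Model l) [⋀^Fin k]→L[ℝ] ℝ} {A : E → Model m →L[ℝ] Model l} {x : E}
    (hη : ContDiffAt ℝ ∞ η x) (hA : ContDiffAt ℝ ∞ A x) :
    ContDiffAt ℝ ∞ (fun z ↦ (η z).compContinuousLinearMap (A z)) x := by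
  refine contDiffAt_continuousAlternatingMap fun v ↦ ?_
  have h1 := (ContinuousMultilinearMap.contDiff
    (F := (ContinuousMultilinearMap ℝ (fun _ : Fin k ↦ Model l) ℝ) →L[ℝ]
      ContinuousMultilinearMap ℝ (fun _ : Fin k ↦ Model m) ℝ)
    (ContinuousMultilinearMap.compContinuousLinearMapContinuousMultilinear ℝ
      (fun _ : Fin k ↦ Model m) (fun _ : Fin k ↦ Model l) ℝ) (n := ∞)).contDiffAt.comp x
    (contDiffAt_pi.2 fun _ : Fin k ↦ hA)
  have h2 := (ContinuousAlternatingMap.toContinuousMultilinearMapCLM ℝ).contDiff.contDiffAt.comp x hη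
  exact (ContinuousLinearMap.contDiff
    (ContinuousMultilinearMap.apply ℝ (fun _ : Fin k ↦ Model m) ℝ v)).contDiffAt.comp x
    (h1.clm_apply h2)

end AlternatingMap

/-! ### Maps and differential forms in charts. -/

section Coordinates

variable {m : ℕ} {M : Type*} [TopologicalSpace M] [ChartedSpace (Model m) M]
  {l : ℕ} {N : Type*} [TopologicalSpace N] [ChartedSpace (Model l) N]

theorem extChartAt_target_mem_nhds_of_mem {c : M} {y : Model m}
    (hy : y ∈ (extChartAt (𝓡 m) c).target) : (extChartAt (𝓡 m) c).target ∈ 𝓝 y :=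
  (isOpen_extChartAt_target c).mem_nhds hy

variable (m l) in
/-- The expression of a map in the charts around `c` and `c'`. -/
def coordRep (c : M) (c' : N) (φ : M → N) : Model m → Model l :=
  fun y ↦ extChartAt (𝓡 l) c' (φ ((extChartAt (𝓡 m) c).symm y))

variable (m l) in
/-- The set where `coordRep` represents the map. -/
def coordDomain (c : M) (c' : N) (φ : M → N) : Set (Model m) :=
  {y | y ∈ (extChartAt (𝓡 m) c).target ∧
    φ ((extChartAt (𝓡 m) c).symm y) ∈ (extChartAt (𝓡 l) c').source}

theorem isOpen_coordDomain (c : M) (c' : N) {φ : M → N} (hφ : Continuous φ) :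
    IsOpen (coordDomain m l c c' φ) := by
  have h := ((continuousOn_extChartAt_symm (I := 𝓡 m) c)).isOpen_inter_preimage
    (isOpen_extChartAt_target c) ((isOpen_extChartAt_source (I := 𝓡 l) c').preimage hφ)
  exact h

theorem coordRep_mem_target {c : M} {c' : N} {φ : M → N} {y : Model m}
    (hy : y ∈ coordDomain m l c c' φ) :
    coordRep m l c c' φ y ∈ (extChartAt (𝓡 l) c').target :=
  (extChartAt (𝓡 l) c').map_source hy.2

theorem extChartAt_symm_coordRep {c : M} {c' : N} {φ : M → N} {y : Model m}
    (hy : y ∈ coordDomain m l c c' φ) :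
    (extChartAt (𝓡 l) c').symm (coordRep m l c c' φ y) = φ ((extChartAt (𝓡 m) c).symm y) :=
  (extChartAt (𝓡 l) c').left_inv hy.2

variable [IsManifold (𝓡 m) ∞ M] [IsManifold (𝓡 l) ∞ N]

theorem contMDiffAt_extChartAt_symm_of_mem {c : M} {y : Model m}
    (hy : y ∈ (extChartAt (𝓡 m) c).target) :
    ContMDiffAt 𝓘(ℝ, Model m) (𝓡 m) ∞ (extChartAt (𝓡 m) c).symm y :=
  (contMDiffOn_extChartAt_symm c).contMDiffAt (extChartAt_target_mem_nhds_of_mem hy)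

theorem contMDiffAt_extChartAt_of_mem {c x : M} (hx : x ∈ (extChartAt (𝓡 m) c).source) :
    ContMDiffAt (𝓡 m) 𝓘(ℝ, Model m) ∞ (extChartAt (𝓡 m) c) x :=
  contMDiffAt_extChartAt' (by simpa using hx)

theorem contDiffAt_coordRep {c : M} {c' : N} {φ : M → N} (hφ : ContMDiff (𝓡 m) (𝓡 l) ∞ φ)
    {y : Model m} (hy : y ∈ coordDomain m l c c' φ) :
    ContDiffAt ℝ ∞ (coordRep m l c c' φ) y := by
  rw [← contMDiffAt_iff_contDiffAt]
  exact (contMDiffAt_extChartAt_of_mem hy.2).comp y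
    ((hφ _).comp y (contMDiffAt_extChartAt_symm_of_mem hy.1))

theorem chartFrame_comp_mfderiv_extChartAt {c x : M} (hx : x ∈ (extChartAt (𝓡 m) c).source)
    (u : Model m) :
    mfderiv 𝓘(ℝ, Model m) (𝓡 m) (extChartAt (𝓡 m) c).symm (extChartAt (𝓡 m) c x)
      (mfderiv (𝓡 m) 𝓘(ℝ, Model m) (extChartAt (𝓡 m) c) x u) = u := by
  have h := mfderivWithin_extChartAt_symm_comp_mfderiv_extChartAt' (I := 𝓡 m) hx
  rw [ModelWithCorners.range_eq_univ, mfderivWithin_univ] at h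
  exact DFunLike.congr_fun h u

theorem mfderiv_extChartAt_chartFrame {c : M} {y : Model m}
    (hy : y ∈ (extChartAt (𝓡 m) c).target) (u : Model m) :
    mfderiv (𝓡 m) 𝓘(ℝ, Model m) (extChartAt (𝓡 m) c) ((extChartAt (𝓡 m) c).symm y)
      (chartFrame m c y u) = u := by
  have h := mfderiv_extChartAt_comp_mfderivWithin_extChartAt_symm (I := 𝓡 m) hy
  rw [ModelWithCorners.range_eq_univ, mfderivWithin_univ] at h
  exact DFunLike.congr_fun h u

theorem chartFrame_injective {c : M} {y : Model m} (hy : y ∈ (extChartAt (𝓡 m) c).target) :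
    Function.Injective (chartFrame m c y) := fun u v h ↦ by
  rw [← mfderiv_extChartAt_chartFrame hy u, h, mfderiv_extChartAt_chartFrame hy v]

theorem chartFrame_surjective {c : M} {y : Model m} (hy : y ∈ (extChartAt (𝓡 m) c).target)
    (u : TangentSpace (𝓡 m) ((extChartAt (𝓡 m) c).symm y)) : ∃ v, chartFrame m c y v = u := by
  refine ⟨mfderiv (𝓡 m) 𝓘(ℝ, Model m) (extChartAt (𝓡 m) c) ((extChartAt (𝓡 m) c).symm y) u, ?_⟩
  have h := mfderivWithin_extChartAt_symm_comp_mfderiv_extChartAt (I := 𝓡 m) hy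
  rw [ModelWithCorners.range_eq_univ, mfderivWithin_univ] at h
  exact DFunLike.congr_fun h u

/-- `d(c' ∘ φ) (∂ᵤ) = D(coordRep) u`. -/
theorem mfderiv_extChartAt_mfderiv_chartFrame {c : M} {c' : N} {φ : M → N}
    (hφ : ContMDiff (𝓡 m) (𝓡 l) ∞ φ) {y : Model m} (hy : y ∈ coordDomain m l c c' φ)
    (u : Model m) :
    mfderiv (𝓡 l) 𝓘(ℝ, Model l) (extChartAt (𝓡 l) c') (φ ((extChartAt (𝓡 m) c).symm y))
      (mfderiv (𝓡 m) (𝓡 l) φ ((extChartAt (𝓡 m) c).symm y) (chartFrame m c y u)) =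
    fderiv ℝ (coordRep m l c c' φ) y u := by
  have h1 := (contMDiffAt_extChartAt_of_mem hy.2).mdifferentiableAt (by simp)
  have h2 := (hφ ((extChartAt (𝓡 m) c).symm y)).mdifferentiableAt (by simp)
  have h3 := (contMDiffAt_extChartAt_symm_of_mem hy.1).mdifferentiableAt (by simp)
  have h4 := HasMFDerivAt.comp y h1.hasMFDerivAt
    (HasMFDerivAt.comp y h2.hasMFDerivAt h3.hasMFDerivAt)
  have h5 := h4.mfderiv
  rw [mfderiv_eq_fderiv] at h5
  exact (DFunLike.congr_fun h5 u).symm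

/-- The coordinate frames are intertwined by a map and its coordinate expression. -/
theorem chartFrame_fderiv_coordRep {c : M} {c' : N} {φ : M → N}
    (hφ : ContMDiff (𝓡 m) (𝓡 l) ∞ φ) {y : Model m} (hy : y ∈ coordDomain m l c c' φ)
    (u : Model m) :
    (chartFrame l c' (coordRep m l c c' φ y) (fderiv ℝ (coordRep m l c c' φ) y u) : Model l) =
      mfderiv (𝓡 m) (𝓡 l) φ ((extChartAt (𝓡 m) c).symm y) (chartFrame m c y u) := by
  rw [← mfderiv_extChartAt_mfderiv_chartFrame hφ hy u]
  exact chartFrame_comp_mfderiv_extChartAt hy.2 _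

/-- All tangent spaces are the same type `Model l` by definition, so the base point can be replaced
without a cast on the vectors. -/
theorem FormField.apply_of_eq {k : ℕ} (η : FormField l N k) {x x' : N} (h : x = x')
    (u : Fin k → Model l) : η x u = η x' u := by subst h; rfl

theorem FormField.pullback_inChart {k : ℕ} (η : FormField l N k) {c : M} {c' : N} {φ : M → N}
    (hφ : ContMDiff (𝓡 m) (𝓡 l) ∞ φ) {y : Model m} (hy : y ∈ coordDomain m l c c' φ) :
    (η.pullback (m := m) φ).inChart c y =
      (η.inChart c' (coordRep m l c c' φ y)).compContinuousLinearMap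
        (fderiv ℝ (coordRep m l c c' φ) y) := by
  ext u
  refine Eq.trans ?_ (η.apply_of_eq (extChartAt_symm_coordRep hy) _).symm
  change η _ _ = η _ _
  congr 1
  ext i : 1
  exact (chartFrame_fderiv_coordRep hφ hy (u i)).symm

theorem FormField.inChart_pullback_eventuallyEq {k : ℕ} (η : FormField l N k) {c : M} {c' : N}
    {φ : M → N} (hφ : ContMDiff (𝓡 m) (𝓡 l) ∞ φ) {y : Model m}
    (hy : y ∈ coordDomain m l c c' φ) :
    (η.pullback (m := m) φ).inChart c =ᶠ[𝓝 y] fun z ↦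
      (η.inChart c' (coordRep m l c c' φ z)).compContinuousLinearMap
        (fderiv ℝ (coordRep m l c c' φ) z) := by
  filter_upwards [(isOpen_coordDomain c c' hφ.continuous).mem_nhds hy] with z hz
  exact η.pullback_inChart hφ hz

theorem FormField.IsSmooth.contDiffAt {k : ℕ} {η : FormField m M k} (h : η.IsSmooth) {c : M}
    {y : Model m} (hy : y ∈ (extChartAt (𝓡 m) c).target) : ContDiffAt ℝ ∞ (η.inChart c) y :=
  (h c).contDiffAt (extChartAt_target_mem_nhds_of_mem hy)

theorem mem_coordDomain_self (φ : M → N) {c : M} {y : Model m}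
    (hy : y ∈ (extChartAt (𝓡 m) c).target) :
    y ∈ coordDomain m l c (φ ((extChartAt (𝓡 m) c).symm y)) φ :=
  ⟨hy, mem_extChartAt_source _⟩

theorem FormField.IsSmooth.pullback {k : ℕ} {η : FormField l N k} (h : η.IsSmooth) {φ : M → N}
    (hφ : ContMDiff (𝓡 m) (𝓡 l) ∞ φ) : (η.pullback (m := m) φ).IsSmooth := by
  intro c y hy
  have hy' := mem_coordDomain_self (l := l) φ hy
  refine ContDiffAt.contDiffWithinAt ?_
  refine ContDiffAt.congr_of_eventuallyEq ?_ (η.inChart_pullback_eventuallyEq hφ hy')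
  have h1 := contDiffAt_coordRep hφ hy'
  have h2 := (h.contDiffAt (coordRep_mem_target hy')).comp y h1
  exact h2.continuousAlternatingMap_compContinuousLinearMap (h1.fderiv_right (by simp))

theorem FormField.IsClosed.pullback {k : ℕ} {η : FormField l N k} (h : η.IsClosed)
    (hs : η.IsSmooth) {φ : M → N}
    (hφ : ContMDiff (𝓡 m) (𝓡 l) ∞ φ) : (η.pullback (m := m) φ).IsClosed := by
  intro c y hy
  have hy' := mem_coordDomain_self (l := l) φ hy
  rw [(η.inChart_pullback_eventuallyEq hφ hy').extDeriv_eq,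
    extDeriv_pullback ((hs.contDiffAt (coordRep_mem_target hy')).differentiableAt (by simp))
      (contDiffAt_coordRep hφ hy') (by simp [ENat.LEInfty.out]), h _ _ (coordRep_mem_target hy')]
  ext; simp

end Coordinates

/-! ### Bilinear forms and metrics in charts, and the induced metric. -/

theorem contDiffAt_bilinearComp {E F F' : Type*} [NormedAddCommGroup E] [NormedSpace ℝ E]
    [NormedAddCommGroup F] [NormedSpace ℝ F] [NormedAddCommGroup F'] [NormedSpace ℝ F']
    {β : E → F' →L[ℝ] F' →L[ℝ] ℝ} {A : E → F →L[ℝ] F'} {x : E}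
    (hβ : ContDiffAt ℝ ∞ β x) (hA : ContDiffAt ℝ ∞ A x) :
    ContDiffAt ℝ ∞ (fun z ↦ (β z).bilinearComp (A z) (A z)) x := by
  have h1 : ContDiffAt ℝ ∞ (fun z ↦ (ContinuousLinearMap.compL ℝ F F' ℝ).flip (A z)) x :=
    ContDiffAt.comp x (ContinuousLinearMap.contDiff _).contDiffAt hA
  exact h1.clm_comp (hβ.clm_comp hA)

section MetricCoordinates

variable {m : ℕ} {M : Type*} [TopologicalSpace M] [ChartedSpace (Model m) M]
  [IsManifold (𝓡 m) ∞ M]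
  {l : ℕ} {N : Type*} [TopologicalSpace N] [ChartedSpace (Model l) N] [IsManifold (𝓡 l) ∞ N]

/-- The coordinate expression of a field of bilinear forms. -/
def bilinInChart (β : ∀ x : M, TangentSpace (𝓡 m) x →L[ℝ] TangentSpace (𝓡 m) x →L[ℝ] ℝ)
    (c : M) (y : Model m) : Model m →L[ℝ] Model m →L[ℝ] ℝ :=
  (ContinuousLinearMap.precomp ℝ (chartFrame m c y)).comp
    ((β ((extChartAt (𝓡 m) c).symm y)).comp (chartFrame m c y))

theorem bilin_apply_of_eq
    (β : ∀ x : M, TangentSpace (𝓡 m) x →L[ℝ] TangentSpace (𝓡 m) x →L[ℝ] ℝ) {x x' : M}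
    (h : x = x') (u v : Model m) : β x u v = β x' u v := by subst h; rfl

set_option synthInstance.maxHeartbeats 200000 in
-- The trivialization at `c` of the bundle of bilinear forms is the one induced by the coordinate
-- frame of the chart at `c`. Smoothness of a metric as a bundle section thus becomes smoothness of
-- its coefficient matrix.
theorem contMDiffAt_bilinSection_iff
    (β : ∀ x : M, TangentSpace (𝓡 m) x →L[ℝ] TangentSpace (𝓡 m) x →L[ℝ] ℝ) (c : M)
    {x : M} (hx : x ∈ (extChartAt (𝓡 m) c).source) :
    ContMDiffAt (𝓡 m) ((𝓡 m).prod 𝓘(ℝ, Model m →L[ℝ] Model m →L[ℝ] ℝ)) ∞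
      (fun b ↦ Bundle.TotalSpace.mk' (Model m →L[ℝ] Model m →L[ℝ] ℝ)
        (E := fun x : M ↦ TangentSpace (𝓡 m) x →L[ℝ] TangentSpace (𝓡 m) x →L[ℝ] ℝ) b (β b)) x ↔
    ContMDiffAt (𝓡 m) 𝓘(ℝ, Model m →L[ℝ] Model m →L[ℝ] ℝ) ∞
      (fun x ↦ bilinInChart β c (extChartAt (𝓡 m) c x)) x := by
  have hx' : x ∈ (chartAt (Model m) c).source := by simpa using hx
  refine ((trivializationAt (Model m →L[ℝ] Model m →L[ℝ] ℝ)
    (fun x : M ↦ TangentSpace (𝓡 m) x →L[ℝ] TangentSpace (𝓡 m) x →L[ℝ] ℝ)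
      c).contMDiffAt_section_iff (IB := 𝓡 m) (n := ∞) (s := β) (by simpa using hx')).trans ?_
  apply Filter.EventuallyEq.contMDiffAt_iff
  filter_upwards [(isOpen_extChartAt_source (I := 𝓡 m) c).mem_nhds hx] with z hz
  have hz' : z ∈ (chartAt (Model m) c).source := by simpa using hz
  rw [hom_trivializationAt_apply]
  ext u v
  simp only [ContinuousLinearMap.inCoordinates]
  rw [ContinuousLinearMap.comp_apply, ContinuousLinearMap.comp_apply,
    TangentBundle.symmL_trivializationAt hz', Bundle.Trivialization.continuousLinearMapAt_apply,
    Bundle.Trivialization.linearMapAt_apply, if_pos (by simpa using hz'), hom_trivializationAt_apply]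
  simp only [ContinuousLinearMap.inCoordinates, TangentBundle.symmL_trivializationAt hz']
  rw [ModelWithCorners.range_eq_univ, mfderivWithin_univ]
  refine Eq.trans ?_ (bilin_apply_of_eq β ((extChartAt (𝓡 m) c).left_inv hz).symm _ _)
  have h := Bundle.Trivial.continuousLinearMapAt_trivialization (𝕜 := ℝ) (B := M) (F := ℝ) z
  exact DFunLike.congr_fun h _

theorem contMDiff_bilinSection_iff
    (β : ∀ x : M, TangentSpace (𝓡 m) x →L[ℝ] TangentSpace (𝓡 m) x →L[ℝ] ℝ) :
    ContMDiff (𝓡 m) ((𝓡 m).prod 𝓘(ℝ, Model m →L[ℝ] Model m →L[ℝ] ℝ)) ∞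
      (fun b ↦ Bundle.TotalSpace.mk' (Model m →L[ℝ] Model m →L[ℝ] ℝ)
        (E := fun x : M ↦ TangentSpace (𝓡 m) x →L[ℝ] TangentSpace (𝓡 m) x →L[ℝ] ℝ) b (β b)) ↔
    ∀ c : M, ∀ y ∈ (extChartAt (𝓡 m) c).target, ContDiffAt ℝ ∞ (bilinInChart β c) y := by
  constructor
  · intro h c y hy
    have h1 := (contMDiffAt_bilinSection_iff β c ((extChartAt (𝓡 m) c).map_target hy)).1 (h _)
    have h2 := h1.comp y (contMDiffAt_extChartAt_symm_of_mem hy)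
    rw [contMDiffAt_iff_contDiffAt] at h2
    refine h2.congr_of_eventuallyEq ?_
    filter_upwards [extChartAt_target_mem_nhds_of_mem hy] with z hz
    exact congrArg _ ((extChartAt (𝓡 m) c).right_inv hz).symm
  · intro h x
    refine (contMDiffAt_bilinSection_iff β x (mem_extChartAt_source x)).2 ?_
    exact (h x _ (mem_extChartAt_target x)).contMDiffAt.comp x
      (contMDiffAt_extChartAt_of_mem (mem_extChartAt_source x))

theorem contDiffAt_metricInChart (g : Metric m M) {c : M} {y : Model m}
    (hy : y ∈ (extChartAt (𝓡 m) c).target) : ContDiffAt ℝ ∞ (metricInChart g c) y :=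
  (contMDiff_bilinSection_iff g.inner).1 g.contMDiff c y hy

theorem metricInChart_apply (g : Metric m M) (c : M) (y u v : Model m) :
    metricInChart g c y u v =
      g.inner ((extChartAt (𝓡 m) c).symm y) (chartFrame m c y u) (chartFrame m c y v) := rfl

theorem metricInChart_symm (g : Metric m M) (c : M) (y u v : Model m) :
    metricInChart g c y u v = metricInChart g c y v u := g.symm _ _ _

theorem metricInChart_pos (g : Metric m M) {c : M} {y : Model m}
    (hy : y ∈ (extChartAt (𝓡 m) c).target) {u : Model m} (hu : u ≠ 0) :
    0 < metricInChart g c y u u :=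
  g.pos _ _ fun h ↦ hu (chartFrame_injective hy (h.trans (map_zero _).symm))

theorem isInvertible_of_pos {G : Model m →L[ℝ] Model m →L[ℝ] ℝ} (hG : ∀ u ≠ 0, 0 < G u u) :
    G.IsInvertible := by
  have hinj : Function.Injective (G : Model m →ₗ[ℝ] (Model m →L[ℝ] ℝ)) := by
    rw [← LinearMap.ker_eq_bot, LinearMap.ker_eq_bot']
    intro u hu
    by_contra h
    have h1 := hG u h
    have h2 : G u = 0 := hu
    simp [h2] at h1
  have hdim : Module.finrank ℝ (Model m) = Module.finrank ℝ (Model m →L[ℝ] ℝ) := by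
    rw [← (LinearMap.toContinuousLinearMap (𝕜 := ℝ) (E := Model m) (F' := ℝ)).finrank_eq]
    exact (Subspace.dual_finrank_eq (K := ℝ) (V := Model m)).symm
  exact ⟨(LinearEquiv.ofInjectiveOfFinrankEq _ hinj hdim).toContinuousLinearEquiv, by ext; rfl⟩

theorem isInvertible_metricInChart (g : Metric m M) {c : M} {y : Model m}
    (hy : y ∈ (extChartAt (𝓡 m) c).target) : (metricInChart g c y).IsInvertible :=
  isInvertible_of_pos fun _ ↦ metricInChart_pos g hy

/-- The pull-back of a field of bilinear forms. -/
def bilinPullback (φ : M → N)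
    (β : ∀ x : N, TangentSpace (𝓡 l) x →L[ℝ] TangentSpace (𝓡 l) x →L[ℝ] ℝ) (x : M) :
    TangentSpace (𝓡 m) x →L[ℝ] TangentSpace (𝓡 m) x →L[ℝ] ℝ :=
  (ContinuousLinearMap.precomp ℝ (mfderiv (𝓡 m) (𝓡 l) φ x)).comp
    ((β (φ x)).comp (mfderiv (𝓡 m) (𝓡 l) φ x))

theorem bilinPullback_apply (φ : M → N)
    (β : ∀ x : N, TangentSpace (𝓡 l) x →L[ℝ] TangentSpace (𝓡 l) x →L[ℝ] ℝ) (x : M)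
    (u v : TangentSpace (𝓡 m) x) :
    bilinPullback φ β x u v =
      β (φ x) (mfderiv (𝓡 m) (𝓡 l) φ x u) (mfderiv (𝓡 m) (𝓡 l) φ x v) := rfl

theorem bilinInChart_pullback
    (β : ∀ x : N, TangentSpace (𝓡 l) x →L[ℝ] TangentSpace (𝓡 l) x →L[ℝ] ℝ)
    {c : M} {c' : N} {φ : M → N}
    (hφ : ContMDiff (𝓡 m) (𝓡 l) ∞ φ) {y : Model m} (hy : y ∈ coordDomain m l c c' φ) :
    bilinInChart (bilinPullback φ β) c y =
      (bilinInChart β c' (coordRep m l c c' φ y)).bilinearComp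
        (fderiv ℝ (coordRep m l c c' φ) y) (fderiv ℝ (coordRep m l c c' φ) y) := by
  ext u v
  refine Eq.trans ?_ (bilin_apply_of_eq β (extChartAt_symm_coordRep hy) _ _).symm
  change β _ (mfderiv (𝓡 m) (𝓡 l) φ _ (chartFrame m c y u))
    (mfderiv (𝓡 m) (𝓡 l) φ _ (chartFrame m c y v)) = β _ _ _
  congr 1
  · congr 1
    exact (chartFrame_fderiv_coordRep hφ hy u).symm
  · exact (chartFrame_fderiv_coordRep hφ hy v).symm

theorem contMDiff_bilinPullback
    {β : ∀ x : N, TangentSpace (𝓡 l) x →L[ℝ] TangentSpace (𝓡 l) x →L[ℝ] ℝ}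
    (hβ : ∀ c : N, ∀ y ∈ (extChartAt (𝓡 l) c).target, ContDiffAt ℝ ∞ (bilinInChart β c) y)
    {φ : M → N} (hφ : ContMDiff (𝓡 m) (𝓡 l) ∞ φ) (c : M) (y : Model m)
    (hy : y ∈ (extChartAt (𝓡 m) c).target) :
    ContDiffAt ℝ ∞ (bilinInChart (bilinPullback (m := m) φ β) c) y := by
  have hy' := mem_coordDomain_self (l := l) φ hy
  have h1 := contDiffAt_coordRep hφ hy'
  refine (contDiffAt_bilinearComp ((hβ _ _ (coordRep_mem_target hy')).comp y h1)
    (h1.fderiv_right (by simp))).congr_of_eventuallyEq ?_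
  filter_upwards [(isOpen_coordDomain c _ hφ.continuous).mem_nhds hy'] with z hz
  exact bilinInChart_pullback β hφ hz

variable {ι : Type*} [Fintype ι] {Y : ι → Type*} [∀ i, TopologicalSpace (Y i)]
  [∀ i, ChartedSpace (Model l) (Y i)] [∀ i, IsManifold (𝓡 l) ∞ (Y i)]

/-- The minimum of $G(w, w)$ over the compact unit sphere is positive and bounds the unit ball of
$G$. This is needed because a `Metric` carries the boundedness of its unit balls as a field. -/
theorem isVonNBounded_of_pos {G : Model m →L[ℝ] Model m →L[ℝ] ℝ} (hG : ∀ u ≠ 0, 0 < G u u) :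
    Bornology.IsVonNBounded ℝ {v : Model m | G v v < 1} := by
  rw [NormedSpace.isVonNBounded_iff]
  -- The sphere is empty only in dimension zero, where there is no minimum to take and the space is
  -- a point.
  rcases (_root_.Metric.sphere (0 : Model m) 1).eq_empty_or_nonempty with he | hne
  · refine (Bornology.isBounded_singleton (x := (0 : Model m))).subset fun v _ ↦ ?_
    by_contra hv
    have h : ‖v‖⁻¹ • v ∈ _root_.Metric.sphere (0 : Model m) 1 := by
      simp [norm_smul, norm_ne_zero_iff.2 hv]
    simp [he] at h
  have hcont : Continuous fun v : Model m ↦ G v v :=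
    G.continuous.clm_apply continuous_id
  obtain ⟨w, hw, hmin⟩ := (isCompact_sphere (0 : Model m) 1).exists_isMinOn hne hcont.continuousOn
  have hw0 : w ≠ 0 := by rintro rfl; simp at hw
  have hpos := hG w hw0
  refine (_root_.Metric.isBounded_closedBall (x := (0 : Model m)) (r := (√(G w w))⁻¹)).subset fun v hv ↦ ?_
  rw [mem_closedBall_zero_iff]
  by_cases hv0 : v = 0
  · simp [hv0]
  have hn : 0 < ‖v‖ := norm_pos_iff.2 hv0
  have h1 : G w w ≤ G (‖v‖⁻¹ • v) (‖v‖⁻¹ • v) :=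
    hmin (by simp [norm_smul, hn.ne'])
  simp only [map_smul, smul_eq_mul, smul_apply] at h1
  have hv1 : G v v < 1 := hv
  have h2 : G w w * ‖v‖ ^ 2 ≤ 1 := by
    calc G w w * ‖v‖ ^ 2 ≤ (‖v‖⁻¹ * (‖v‖⁻¹ * G v v)) * ‖v‖ ^ 2 := by gcongr
      _ = G v v := by field_simp
      _ ≤ 1 := hv1.le
  rw [← one_div, le_div_iff₀ (Real.sqrt_pos.2 hpos)]
  refine le_of_sq_le_sq ?_ zero_le_one
  rw [mul_pow, Real.sq_sqrt hpos.le]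
  linarith

/-- The metric induced by an immersion into a product of Riemannian manifolds. -/
def inducedMetric (g : ∀ i, Metric l (Y i)) (φ : ∀ i, M → Y i)
    (hφ : ∀ i, ContMDiff (𝓡 m) (𝓡 l) ∞ (φ i))
    (himm : ∀ (p : M) (u : TangentSpace (𝓡 m) p),
      (∀ i, mfderiv (𝓡 m) (𝓡 l) (φ i) p u = 0) → u = 0) : Metric m M :=
  have hpos : ∀ (p : M) (u : TangentSpace (𝓡 m) p), u ≠ 0 →
      0 < (∑ i, bilinPullback (m := m) (φ i) (g i).inner p) u u := by
    intro p u hu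
    simp only [sum_apply]
    have hnn : ∀ i (w : TangentSpace (𝓡 l) (φ i p)), 0 ≤ (g i).inner (φ i p) w w := by
      intro i w
      by_cases hw : w = 0
      · simp [hw]
      · exact ((g i).pos _ w hw).le
    refine Finset.sum_pos' (fun i _ ↦ hnn i (mfderiv (𝓡 m) (𝓡 l) (φ i) p u)) ?_
    by_contra! hcon
    refine hu (himm p u fun i ↦ ?_)
    by_contra h
    exact absurd (hcon i (Finset.mem_univ i)) (not_le.2 ((g i).pos _ _ h))
  { inner := fun p ↦ ∑ i, bilinPullback (m := m) (φ i) (g i).inner p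
    symm := by
      intro p u v
      simp only [sum_apply]
      exact Finset.sum_congr rfl fun i _ ↦ (g i).symm (φ i p) _ _
    pos := hpos
    isVonNBounded := fun p ↦ isVonNBounded_of_pos (hpos p)
    contMDiff := by
      rw [contMDiff_bilinSection_iff]
      intro c y hy
      have h : bilinInChart (fun p ↦ ∑ i, bilinPullback (m := m) (φ i) (g i).inner p) c =
          fun y ↦ ∑ i, bilinInChart (bilinPullback (m := m) (φ i) (g i).inner) c y := by
        ext y u v
        change (∑ i, bilinPullback (m := m) (φ i) (g i).inner _) _ _ = (∑ i, bilinInChart (bilinPullback (m := m) (φ i) (g i).inner) c y) u v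
        simp only [sum_apply]
        rfl
      rw [h]
      exact ContDiffAt.sum fun i _ ↦ contMDiff_bilinPullback
        (fun c y hy ↦ contDiffAt_metricInChart (g i) hy) (hφ i) c y hy }

theorem inducedMetric_inner (g : ∀ i, Metric l (Y i)) (φ : ∀ i, M → Y i)
    (hφ : ∀ i, ContMDiff (𝓡 m) (𝓡 l) ∞ (φ i))
    (himm : ∀ (p : M) (u : TangentSpace (𝓡 m) p),
      (∀ i, mfderiv (𝓡 m) (𝓡 l) (φ i) p u = 0) → u = 0) (p : M) (u v : TangentSpace (𝓡 m) p) :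
    (inducedMetric g φ hφ himm).inner p u v = ∑ i, (g i).inner (φ i p)
      (mfderiv (𝓡 m) (𝓡 l) (φ i) p u) (mfderiv (𝓡 m) (𝓡 l) (φ i) p v) := by
  change (∑ i, bilinPullback (m := m) (φ i) (g i).inner p) u v = _
  simp only [sum_apply]
  exact Finset.sum_congr rfl fun i _ ↦ bilinPullback_apply _ _ _ _ _

end MetricCoordinates

/-! ### Koszul formula and second fundamental form in vector spaces. -/

section Koszul

variable {E F : Type*} [NormedAddCommGroup E] [NormedSpace ℝ E]
  [NormedAddCommGroup F] [NormedSpace ℝ F]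

/-- The Christoffel symbol of a metric on a vector space. -/
def christoffelOf (G : E → E →L[ℝ] E →L[ℝ] ℝ) (y u v : E) : E :=
  (G y).inverse ((1 / 2 : ℝ) •
    (fderiv ℝ G y u v + fderiv ℝ G y v u - ((fderiv ℝ G y).flip u).flip v))

theorem apply_inverse_of_isInvertible {G : E →L[ℝ] F} (hG : G.IsInvertible) (a : F) :
    G (G.inverse a) = a := by
  obtain ⟨e, rfl⟩ := hG
  simp

theorem apply_christoffelOf {G : E → E →L[ℝ] E →L[ℝ] ℝ} {y : E} (hG : (G y).IsInvertible)
    (u v w : E) : G y (christoffelOf G y u v) w =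
      (1 / 2 : ℝ) * (fderiv ℝ G y u v w + fderiv ℝ G y v u w - fderiv ℝ G y w u v) := by
  rw [christoffelOf, apply_inverse_of_isInvertible hG]
  simp

/-- The Christoffel symbol as a bilinear map. -/
def christoffelL (G : E → E →L[ℝ] E →L[ℝ] ℝ) (y : E) : E →L[ℝ] E →L[ℝ] E :=
  (ContinuousLinearMap.compL ℝ E (E →L[ℝ] ℝ) E (G y).inverse).comp ((1 / 2 : ℝ) •
    (fderiv ℝ G y + (fderiv ℝ G y).flip -
      ((ContinuousLinearMap.flipₗᵢ ℝ E E ℝ).toContinuousLinearEquiv : (E →L[ℝ] E →L[ℝ] ℝ) →L[ℝ]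
        (E →L[ℝ] E →L[ℝ] ℝ)).comp (fderiv ℝ G y).flip))

theorem christoffelL_apply (G : E → E →L[ℝ] E →L[ℝ] ℝ) (y u v : E) :
    christoffelL G y u v = christoffelOf G y u v := rfl

theorem contDiffAt_christoffelL [CompleteSpace E] {G : E → E →L[ℝ] E →L[ℝ] ℝ} {y : E}
    (hG : ContDiffAt ℝ ∞ G y) (hinv : (G y).IsInvertible) :
    ContDiffAt ℝ ∞ (christoffelL G) y := by
  have h1 : ContDiffAt ℝ ∞ (fun z ↦ (G z).inverse) y := by
    obtain ⟨e, he⟩ := hinv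
    have h2 : ContDiffAt ℝ ∞ ContinuousLinearMap.inverse (G y) := by
      rw [← he]; exact contDiffAt_map_inverse e
    exact ContDiffAt.comp y h2 hG
  have h2 : ContDiffAt ℝ ∞ (fderiv ℝ G) y := hG.fderiv_right (by simp)
  have h3 : ContDiffAt ℝ ∞ (fun z ↦ (fderiv ℝ G z).flip) y :=
    ContDiffAt.comp y ((ContinuousLinearMap.flipₗᵢ ℝ E E
      (E →L[ℝ] ℝ)).toContinuousLinearEquiv.contDiff.contDiffAt) h2
  have h4 : ContDiffAt ℝ ∞ (fun z ↦ ContinuousLinearMap.compL ℝ E (E →L[ℝ] ℝ) E (G z).inverse) y :=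
    ContDiffAt.comp y (ContinuousLinearMap.contDiff _).contDiffAt h1
  exact h4.clm_comp (((h2.add h3).sub (contDiffAt_const.clm_comp h3)).const_smul (1 / 2 : ℝ))

/-- The failure of `Φ` to intertwine the Christoffel symbols of `G` and `H`. -/
def christoffelDefect (G : E → E →L[ℝ] E →L[ℝ] ℝ) (H : F → F →L[ℝ] F →L[ℝ] ℝ) (Φ : E → F)
    (y u v : E) : F :=
  fderiv ℝ Φ y (christoffelOf G y u v) -
    christoffelOf H (Φ y) (fderiv ℝ Φ y u) (fderiv ℝ Φ y v) - fderiv ℝ (fderiv ℝ Φ) y u v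

theorem fderiv_fderiv_symm {Φ : E → F} {y : E} (hΦ : ContDiffAt ℝ ∞ Φ y) (u v : E) :
    fderiv ℝ (fderiv ℝ Φ) y u v = fderiv ℝ (fderiv ℝ Φ) y v u :=
  (hΦ.isSymmSndFDerivAt (by simp [ENat.LEInfty.out])) u v

theorem _root_.ContDiffAt.differentiableAt_fderiv {Φ : E → F} {y : E} (hΦ : ContDiffAt ℝ ∞ Φ y) :
    DifferentiableAt ℝ (fderiv ℝ Φ) y :=
  (hΦ.fderiv_right (m := ∞) (by simp)).differentiableAt (by simp)

theorem hasFDerivAt_pullback_metric {H : F → F →L[ℝ] F →L[ℝ] ℝ} {Φ : E → F} {y : E}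
    (hH : DifferentiableAt ℝ H (Φ y)) (hΦ : ContDiffAt ℝ ∞ Φ y) (v w : E) :
    ∃ L : E →L[ℝ] ℝ, HasFDerivAt (fun z ↦ H (Φ z) (fderiv ℝ Φ z v) (fderiv ℝ Φ z w)) L y ∧
      ∀ u, L u = fderiv ℝ H (Φ y) (fderiv ℝ Φ y u) (fderiv ℝ Φ y v) (fderiv ℝ Φ y w) +
        H (Φ y) (fderiv ℝ (fderiv ℝ Φ) y u v) (fderiv ℝ Φ y w) +
        H (Φ y) (fderiv ℝ Φ y v) (fderiv ℝ (fderiv ℝ Φ) y u w) := by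
  have h1 := hH.hasFDerivAt.comp y (hΦ.differentiableAt (by simp)).hasFDerivAt
  have h2 := hΦ.differentiableAt_fderiv.hasFDerivAt
  have h3 := h2.clm_apply (hasFDerivAt_const v y)
  have h4 := h2.clm_apply (hasFDerivAt_const w y)
  refine ⟨_, (h1.clm_apply h3).clm_apply h4, fun u ↦ ?_⟩
  simp
  ring

/-- The second fundamental form of an isometric immersion into a product is normal to the image.
Differentiating the pulled-back metric gives terms with $D^2\Phi_i$. In the Koszul combination the
symmetry of $D^2\Phi_i$ cancels all of them except $2H_i(D^2\Phi_i(u,v), D\Phi_i w)$. A one-element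
index set gives the transformation law under chart changes, and the general case serves the fibre
product. -/
theorem sum_metric_christoffelDefect {ι : Type*} [Fintype ι] {G : E → E →L[ℝ] E →L[ℝ] ℝ}
    {H : ι → F → F →L[ℝ] F →L[ℝ] ℝ} {Φ : ι → E → F} {y : E} (hG : (G y).IsInvertible)
    (hGd : DifferentiableAt ℝ G y)
    (hH : ∀ i, (H i (Φ i y)).IsInvertible) (hHd : ∀ i, DifferentiableAt ℝ (H i) (Φ i y))
    (hHs : ∀ i z u v, H i z u v = H i z v u) (hΦ : ∀ i, ContDiffAt ℝ ∞ (Φ i) y)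
    (heq : ∀ u v, ∀ᶠ z in 𝓝 y,
      G z u v = ∑ i, H i (Φ i z) (fderiv ℝ (Φ i) z u) (fderiv ℝ (Φ i) z v)) (u v w : E) :
    ∑ i, H i (Φ i y) (christoffelDefect G (H i) (Φ i) y u v) (fderiv ℝ (Φ i) y w) = 0 := by
  choose L hL hLu using fun i v w ↦ hasFDerivAt_pullback_metric (hHd i) (hΦ i) v w
  have hDG : ∀ u v w, fderiv ℝ G y u v w = ∑ i, L i v w u := by
    intro u v w
    have h1 : HasFDerivAt (fun z ↦ G z v w) (∑ i, L i v w) y :=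
      (HasFDerivAt.fun_sum fun i _ ↦ hL i v w).congr_of_eventuallyEq (heq v w)
    have h2 := (hGd.hasFDerivAt.clm_apply (hasFDerivAt_const v y)).clm_apply
      (hasFDerivAt_const w y)
    have h3 := DFunLike.congr_fun (h2.unique h1) u
    simpa using h3
  have hK := apply_christoffelOf hG u v w
  rw [hDG, hDG, hDG, (heq _ _).self_of_nhds, ← Finset.sum_add_distrib, ← Finset.sum_sub_distrib,
    Finset.mul_sum, ← sub_eq_zero, ← Finset.sum_sub_distrib] at hK
  rw [← hK]
  refine Finset.sum_congr rfl fun i _ ↦ ?_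
  rw [hLu, hLu, hLu, christoffelDefect]
  simp only [map_sub, sub_apply]
  rw [apply_christoffelOf (hH i), fderiv_fderiv_symm (hΦ i) v u, fderiv_fderiv_symm (hΦ i) w u,
    fderiv_fderiv_symm (hΦ i) w v, hHs i _ (fderiv ℝ (Φ i) y u) (fderiv ℝ (fderiv ℝ (Φ i)) y v w),
    hHs i _ (fderiv ℝ (Φ i) y v) (fderiv ℝ (fderiv ℝ (Φ i)) y u w)]
  ring

end Koszul

/-! ### Christoffel symbols under change of charts. -/

section Charts

variable {m : ℕ} {M : Type*} [TopologicalSpace M] [ChartedSpace (Model m) M]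
  [IsManifold (𝓡 m) ∞ M]

theorem christoffel_eq (g : Metric m M) (c : M) (y u v : Model m) :
    christoffel g c y u v = christoffelOf (metricInChart g c) y u v := rfl

theorem contDiffAt_id_coordRep {c c' : M} {y : Model m} (hy : y ∈ coordDomain m m c c' id) :
    ContDiffAt ℝ ∞ (coordRep m m c c' id) y :=
  contDiffAt_coordRep contMDiff_id hy

theorem eventually_metricInChart_id (g : Metric m M) {c c' : M} {y : Model m}
    (hy : y ∈ coordDomain m m c c' id) : ∀ᶠ z in 𝓝 y, ∀ u v,
      metricInChart g c z u v = metricInChart g c' (coordRep m m c c' id z)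
        (fderiv ℝ (coordRep m m c c' id) z u) (fderiv ℝ (coordRep m m c c' id) z v) := by
  filter_upwards [(isOpen_coordDomain c c' continuous_id).mem_nhds hy] with z hz u v
  rw [metricInChart_apply, metricInChart_apply]
  refine Eq.trans ?_ (bilin_apply_of_eq g.inner (extChartAt_symm_coordRep hz) _ _).symm
  have h := chartFrame_fderiv_coordRep contMDiff_id hz
  simp only [mfderiv_id] at h
  congr 1
  · congr 1
    exact (h u).symm
  · exact (h v).symm

theorem fderiv_transition_surjective {c c' : M} {y : Model m} (hy : y ∈ coordDomain m m c c' id) :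
    Function.Surjective (fderiv ℝ (coordRep m m c c' id) y) := by
  have hinj : Function.Injective (fderiv ℝ (coordRep m m c c' id) y) := by
    intro u v huv
    have h := chartFrame_fderiv_coordRep contMDiff_id hy
    simp only [mfderiv_id] at h
    refine chartFrame_injective hy.1 ?_
    exact (h u).symm.trans ((congrArg _ huv).trans (h v))
  exact (LinearMap.injective_iff_surjective (f := (fderiv ℝ (coordRep m m c c' id) y).toLinearMap)).1
    hinj

/-- The transformation law of the Christoffel symbols. -/
theorem christoffelDefect_transition (g : Metric m M) {c c' : M} {y : Model m}
    (hy : y ∈ coordDomain m m c c' id) (u v : Model m) :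
    christoffelDefect (metricInChart g c) (metricInChart g c') (coordRep m m c c' id) y u v = 0 := by
  have hy' := coordRep_mem_target hy
  have h := sum_metric_christoffelDefect (ι := Unit) (H := fun _ ↦ metricInChart g c')
    (Φ := fun _ ↦ coordRep m m c c' id) (isInvertible_metricInChart g hy.1)
    ((contDiffAt_metricInChart g hy.1).differentiableAt (by simp))
    (fun _ ↦ isInvertible_metricInChart g hy')
    (fun _ ↦ (contDiffAt_metricInChart g hy').differentiableAt (by simp))
    (fun _ ↦ metricInChart_symm g c') (fun _ ↦ contDiffAt_id_coordRep hy)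
    (fun u v ↦ (eventually_metricInChart_id g hy).mono fun z hz ↦ by simpa using hz u v) u v
  simp only [Finset.univ_unique, Finset.sum_singleton] at h
  -- The defect is orthogonal to the image of the derivative of the transition map, which is
  -- everything, so the defect is orthogonal to itself.
  by_contra hne
  obtain ⟨w, hw⟩ := fderiv_transition_surjective hy
    (christoffelDefect (metricInChart g c) (metricInChart g c') (coordRep m m c c' id) y u v)
  have h1 := h w
  rw [hw] at h1
  exact (metricInChart_pos g hy' hne).ne' h1

theorem contDiffAt_christoffelL_metricInChart (g : Metric m M) {c : M} {y : Model m}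
    (hy : y ∈ (extChartAt (𝓡 m) c).target) :
    ContDiffAt ℝ ∞ (christoffelL (metricInChart g c)) y :=
  contDiffAt_christoffelL (contDiffAt_metricInChart g hy) (isInvertible_metricInChart g hy)

end Charts

/-! ### Linear differential equations along lines. -/

section LinearODE

variable {E : Type*} [NormedAddCommGroup E] [NormedSpace ℝ E]

/-- The equation depends on time through the point $y + tu$. Adding the position as an unknown with
constant velocity $u$ makes it autonomous with a $C^1$ right-hand side, and the position component
of a solution must be $y + tu$. -/
theorem exists_local_solution_along_line [CompleteSpace E] {A : E → E →L[ℝ] E →L[ℝ] E} {y : E}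
    (hA : ContDiffAt ℝ 1 A y) (u v : E) :
    ∃ ξ : ℝ → E, ξ 0 = v ∧ ∃ ε > (0 : ℝ), ∀ t ∈ Set.Ioo (-ε) ε,
      HasDerivAt ξ (-(A (y + t • u) u (ξ t))) t := by
  have hF : ContDiffAt ℝ 1 (fun p : E × E ↦ (u, -(A p.1 u p.2))) (y, v) := by
    have h1 : ContDiffAt ℝ 1 (fun p : E × E ↦ A p.1) (y, v) :=
      ContDiffAt.comp (y, v) hA contDiffAt_fst
    exact contDiffAt_const.prodMk ((h1.clm_apply contDiffAt_const).clm_apply contDiffAt_snd).neg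
  obtain ⟨α, hα0, ε, hε, hα⟩ :=
    hF.exists_forall_mem_closedBall_exists_eq_forall_mem_Ioo_hasDerivAt₀ 0
  simp only [zero_sub, zero_add] at hα
  have hfst : ∀ t ∈ Set.Ioo (-ε) ε, (α t).1 = y + t • u := by
    have h1 : ∀ t ∈ Set.Ioo (-ε) ε, HasDerivAt (fun t ↦ (α t).1 - t • u) 0 t := by
      intro t ht
      have h2 : HasDerivAt (fun t ↦ (α t).1) u t :=
        (hasFDerivAt_fst (𝕜 := ℝ) (E := E) (F := E)).comp_hasDerivAt t (hα t ht)
      have h3 := h2.sub ((hasDerivAt_id t).smul_const u)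
      rw [one_smul, sub_self] at h3
      exact h3
    intro t ht
    have h3 := isOpen_Ioo.is_const_of_deriv_eq_zero isPreconnected_Ioo
      (fun t ht ↦ (h1 t ht).differentiableAt.differentiableWithinAt) (fun t ht ↦ (h1 t ht).deriv)
      ht (show (0 : ℝ) ∈ Set.Ioo (-ε) ε by simp [hε])
    simp only [hα0, zero_smul, sub_zero] at h3
    exact sub_eq_iff_eq_add.1 h3
  refine ⟨fun t ↦ (α t).2, by simp [hα0], ε, hε, fun t ht ↦ ?_⟩
  have h := (hasFDerivAt_snd (𝕜 := ℝ) (E := E) (F := E)).comp_hasDerivAt t (hα t ht)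
  simp only [hfst t ht] at h
  exact h

theorem hasDerivAt_fderiv_apply_line {E' : Type*} [NormedAddCommGroup E'] [NormedSpace ℝ E']
    {F : E → E'} {y : E} (hF : DifferentiableAt ℝ (fderiv ℝ F) y) (u : E) {ξ : ℝ → E} {ξ' : E}
    (hξ : HasDerivAt ξ ξ' 0) : HasDerivAt (fun δ : ℝ ↦ fderiv ℝ F (y + δ • u) (ξ δ))
      (fderiv ℝ (fderiv ℝ F) y u (ξ 0) + fderiv ℝ F y ξ') 0 := by
  have hline : HasDerivAt (fun δ : ℝ ↦ y + δ • u) u 0 := by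
    simpa using ((hasDerivAt_id (0 : ℝ)).smul_const u).const_add y
  have hD : HasDerivAt (fun δ : ℝ ↦ fderiv ℝ F (y + δ • u)) (fderiv ℝ (fderiv ℝ F) y u) 0 :=
    HasFDerivAt.comp_hasDerivAt_of_eq 0 hF.hasFDerivAt hline (by rw [zero_smul, add_zero])
  have h2 := hD.clm_apply hξ
  rw [zero_smul, add_zero] at h2
  exact h2

theorem linear_ode_unique {L : ℝ → E →L[ℝ] E} (hL : ContinuousOn L (Set.Icc 0 1)) {f g : ℝ → E}
    (hf : ∀ t ∈ Set.Icc (0 : ℝ) 1, HasDerivWithinAt f (L t (f t)) (Set.Icc 0 1) t)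
    (hg : ∀ t ∈ Set.Icc (0 : ℝ) 1, HasDerivWithinAt g (L t (g t)) (Set.Icc 0 1) t)
    (h0 : f 0 = g 0) : Set.EqOn f g (Set.Icc 0 1) := by
  obtain ⟨K, hK⟩ := isCompact_Icc.exists_bound_of_continuousOn hL
  have hstep : ∀ {f : ℝ → E} {f' : E} {t : ℝ}, t ∈ Set.Ico (0 : ℝ) 1 →
      HasDerivWithinAt f f' (Set.Icc 0 1) t → HasDerivWithinAt f f' (Set.Ici t) t :=
    fun ht h ↦ h.mono_of_mem_nhdsWithin (Icc_mem_nhdsGE_of_mem ht)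
  refine ODE_solution_unique_of_mem_Icc_right (v := fun t x ↦ L t x) (s := fun _ ↦ Set.univ)
    (K := K.toNNReal) (fun t ht ↦ ?_) (fun t ht ↦ (hf t ht).continuousWithinAt)
    (fun t ht ↦ hstep ht (hf t (Set.Ico_subset_Icc_self ht))) (fun _ _ ↦ Set.mem_univ _)
    (fun t ht ↦ (hg t ht).continuousWithinAt)
    (fun t ht ↦ hstep ht (hg t (Set.Ico_subset_Icc_self ht))) (fun _ _ ↦ Set.mem_univ _) h0
  refine ((L t).lipschitz.weaken ?_).lipschitzOnWith
  have h := hK t (Set.Ico_subset_Icc_self ht)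
  exact NNReal.coe_le_coe.1 (h.trans (Real.le_coe_toNNReal K))

/-- If the time-one values of the rescaled linear equations are `P`, then `P` solves the equation. -/
theorem hasDerivWithinAt_of_linear_ode {Λ : ℝ → E →L[ℝ] E} {P : ℝ → E} {w : E} {δ₀ : ℝ}
    (hδ₀ : 0 < δ₀) (hΛ : ContinuousOn Λ (Set.Icc 0 δ₀))
    (hex : ∀ δ ∈ Set.Icc (0 : ℝ) δ₀, ∃ ζ : ℝ → E,
      (∀ t ∈ Set.Icc (0 : ℝ) 1, HasDerivWithinAt ζ ((δ • Λ (t * δ)) (ζ t)) (Set.Icc 0 1) t) ∧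
      ζ 0 = w ∧ ζ 1 = P δ) :
    HasDerivWithinAt P (Λ 0 w) (Set.Icc 0 δ₀) 0 := by
  have hmul : ∀ δ ∈ Set.Icc (0 : ℝ) δ₀, ∀ t ∈ Set.Icc (0 : ℝ) 1, t * δ ∈ Set.Icc (0 : ℝ) δ₀ :=
    fun δ hδ t ht ↦ ⟨mul_nonneg ht.1 hδ.1,
      (mul_le_of_le_one_left hδ.1 ht.2).trans hδ.2⟩
  obtain ⟨Z, hZ, hZ0, -⟩ := hex δ₀ ⟨hδ₀.le, le_rfl⟩
  have hunit : ∀ δ ∈ Set.Icc (0 : ℝ) δ₀, ∀ t ∈ Set.Icc (0 : ℝ) 1,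
      t * (δ / δ₀) ∈ Set.Icc (0 : ℝ) 1 := fun δ hδ t ht ↦
    ⟨mul_nonneg ht.1 (div_nonneg hδ.1 hδ₀.le),
      mul_le_one₀ ht.2 (div_nonneg hδ.1 hδ₀.le) ((div_le_one hδ₀).2 hδ.2)⟩
  -- By uniqueness the solution for $\delta$ is the solution $Z$ for $\delta_0$ run at speed
  -- $\delta/\delta_0$. So $P$ is a reparametrization of one curve, which gives its derivative at
  -- $0$.
  have hZend : ∀ δ ∈ Set.Icc (0 : ℝ) δ₀, P δ = Z (δ / δ₀) := by
    intro δ hδ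
    obtain ⟨ζ, hζ, hζ0, hζ1⟩ := hex δ hδ
    have hLc : ContinuousOn (fun t ↦ δ • Λ (t * δ)) (Set.Icc 0 1) :=
      ((hΛ.comp (by fun_prop) (fun t ht ↦ hmul δ hδ t ht)).const_smul δ)
    have hZ' : ∀ t ∈ Set.Icc (0 : ℝ) 1, HasDerivWithinAt (fun t ↦ Z (t * (δ / δ₀)))
        ((δ • Λ (t * δ)) (Z (t * (δ / δ₀)))) (Set.Icc 0 1) t := by
      intro t ht
      have h1 := (hZ _ (hunit δ hδ t ht)).scomp t
        ((hasDerivAt_id t).mul_const (δ / δ₀)).hasDerivWithinAt (fun t ht ↦ hunit δ hδ t ht)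
      have h2 : t * (δ / δ₀) * δ₀ = t * δ := by field_simp
      rw [h2, one_mul, smul_apply, smul_smul, div_mul_cancel₀ _ hδ₀.ne'] at h1
      exact h1
    have h1 := linear_ode_unique hLc hζ hZ' (by simp [hζ0, hZ0]) (Set.right_mem_Icc.2 zero_le_one)
    rw [← hζ1, h1]
    simp only [one_mul]
  have hright : HasDerivWithinAt (fun δ : ℝ ↦ Z (δ / δ₀)) (Λ 0 w)
      (Set.Icc 0 δ₀) 0 := by
    have h1 := hZ 0 (by simp)
    have h2 : HasDerivWithinAt (fun δ : ℝ ↦ δ / δ₀) (1 / δ₀) (Set.Icc 0 δ₀) 0 :=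
      ((hasDerivAt_id (0 : ℝ)).div_const δ₀).hasDerivWithinAt
    have h3 := HasDerivWithinAt.scomp_of_eq (0 : ℝ) h1 h2
      (fun t ht ↦ by simpa using hunit t ht 1 (by simp)) (by simp)
    rw [zero_mul, hZ0, smul_apply, smul_smul, one_div_mul_cancel hδ₀.ne', one_smul] at h3
    exact h3
  exact hright.congr hZend (hZend 0 ⟨le_rfl, hδ₀.le⟩)

end LinearODE

/-! ### Parallel fields seen from different charts. -/

section ParallelFields

variable {m : ℕ} {M : Type*} [TopologicalSpace M] [ChartedSpace (Model m) M]
  [IsManifold (𝓡 m) ∞ M]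

/-- A solution of the equation of parallel transport in one chart is parallel. -/
theorem isParallelAlong_of_chart (g : Metric m M) (c : M) {y y' ξ : ℝ → Model m}
    (hyt : ∀ t ∈ Set.Icc (0 : ℝ) 1, y t ∈ (extChartAt (𝓡 m) c).target)
    (hy : ∀ t ∈ Set.Icc (0 : ℝ) 1, HasDerivWithinAt y (y' t) (Set.Icc 0 1) t)
    (hξ : ∀ t ∈ Set.Icc (0 : ℝ) 1, HasDerivWithinAt ξ (-christoffel g c (y t) (y' t) (ξ t))
      (Set.Icc 0 1) t) :
    IsParallelAlong g (fun t ↦ (extChartAt (𝓡 m) c).symm (y t))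
      (fun t ↦ chartFrame m c (y t) (ξ t)) := by
  intro t ht c' hc'
  have hdom : y t ∈ coordDomain m m c c' id := ⟨hyt t ht, hc'⟩
  set Ψ := coordRep m m c c' id with hΨ
  have hΨd := contDiffAt_id_coordRep hdom
  have hy1 : HasDerivWithinAt (fun τ ↦ Ψ (y τ)) (fderiv ℝ Ψ (y t) (y' t)) (Set.Icc 0 1) t :=
    (hΨd.differentiableAt (by simp)).hasFDerivAt.comp_hasDerivWithinAt t (hy t ht)
  have hD : HasDerivWithinAt (fun τ ↦ fderiv ℝ Ψ (y τ)) (fderiv ℝ (fderiv ℝ Ψ) (y t) (y' t))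
      (Set.Icc 0 1) t :=
    hΨd.differentiableAt_fderiv.hasFDerivAt.comp_hasDerivWithinAt t (hy t ht)
  have hξ1 := hD.clm_apply (hξ t ht)
  have hev : ∀ᶠ τ in 𝓝[Set.Icc 0 1] t, mfderiv (𝓡 m) 𝓘(ℝ, Model m) (extChartAt (𝓡 m) c')
      ((extChartAt (𝓡 m) c).symm (y τ)) (chartFrame m c (y τ) (ξ τ)) =
      fderiv ℝ Ψ (y τ) (ξ τ) := by
    filter_upwards [(hy t ht).continuousWithinAt
      ((isOpen_coordDomain c c' continuous_id).mem_nhds hdom)] with τ hτ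
    have h := mfderiv_extChartAt_mfderiv_chartFrame contMDiff_id hτ (ξ τ)
    simp only [mfderiv_id] at h
    exact h
  have hyw : derivWithin (fun τ ↦ extChartAt (𝓡 m) c' ((extChartAt (𝓡 m) c).symm (y τ)))
      (Set.Icc 0 1) t = fderiv ℝ Ψ (y t) (y' t) :=
    hy1.derivWithin (uniqueDiffOn_Icc zero_lt_one t ht)
  intro Y Ξ
  have hΞ : Ξ t = fderiv ℝ Ψ (y t) (ξ t) := hev.self_of_nhdsWithin ht
  have hdef := christoffelDefect_transition g hdom (y' t) (ξ t)
  rw [hΞ, show derivWithin Y (Set.Icc 0 1) t = _ from hyw]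
  refine HasDerivWithinAt.congr_of_eventuallyEq ?_ hev hΞ
  convert hξ1 using 1
  -- The term $D^2\Psi(y', \xi)$ of the product rule is the correction in the transformation law of
  -- the Christoffel symbols.
  rw [christoffelDefect, sub_sub, sub_eq_zero] at hdef
  rw [map_neg, christoffel_eq g c, hdef, christoffel_eq]
  change -christoffelOf _ (Ψ (y t)) _ _ = _
  abel

end ParallelFields

/-! ### Covariant constant maps have vanishing second fundamental form. -/

section CovariantConstant

variable {m : ℕ} {M : Type*} [TopologicalSpace M] [ChartedSpace (Model m) M]
  [IsManifold (𝓡 m) ∞ M]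
  {n : ℕ} {B : Type*} [TopologicalSpace B] [ChartedSpace (Model n) B] [IsManifold (𝓡 n) ∞ B]

/-- The image of a parallel field along a coordinate line under a covariant constant map, in a
chart of the base. -/
theorem exists_parallel_image {g : Metric m M} {h : Metric n B} {f : M → B}
    (hf : ContMDiff (𝓡 m) (𝓡 n) ∞ f) (hcov : IsCovariantConstant g h f) {c : M} {c' : B}
    {y u : Model m} {ξ : ℝ → Model m} {δ : ℝ}
    (hdom : ∀ t ∈ Set.Icc (0 : ℝ) 1, y + (t * δ) • u ∈ coordDomain m n c c' f)
    (hξ : ∀ t ∈ Set.Icc (0 : ℝ) 1, HasDerivAt ξ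
      (-christoffelL (metricInChart g c) (y + (t * δ) • u) u (ξ (t * δ))) (t * δ)) :
    ∃ ζ : ℝ → Model n, (∀ t ∈ Set.Icc (0 : ℝ) 1, HasDerivWithinAt ζ
      ((δ • -christoffelL (metricInChart h c') (coordRep m n c c' f (y + (t * δ) • u))
        (fderiv ℝ (coordRep m n c c' f) (y + (t * δ) • u) u)) (ζ t)) (Set.Icc 0 1) t) ∧
      ζ 0 = fderiv ℝ (coordRep m n c c' f) y (ξ 0) ∧
      ζ 1 = fderiv ℝ (coordRep m n c c' f) (y + δ • u) (ξ δ) := by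
  have hline : ∀ t : ℝ, HasDerivAt (fun τ : ℝ ↦ y + (τ * δ) • u) (δ • u) t := by
    intro t
    simpa using (((hasDerivAt_id t).mul_const δ).smul_const u).const_add y
  have hpar : IsParallelAlong g (fun t : ℝ ↦ (extChartAt (𝓡 m) c).symm (y + (t * δ) • u))
      (fun t ↦ chartFrame m c (y + (t * δ) • u) (ξ (t * δ))) := by
    refine isParallelAlong_of_chart g c (y := fun t : ℝ ↦ y + (t * δ) • u) (y' := fun _ ↦ δ • u)
      (ξ := fun t ↦ ξ (t * δ)) (fun t ht ↦ (hdom t ht).1) (fun t _ ↦ (hline t).hasDerivWithinAt)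
      (fun t ht ↦ ?_)
    have h1 := (hξ t ht).scomp t ((hasDerivAt_id t).mul_const δ)
    rw [christoffel_eq, ← christoffelL_apply]
    simp only [map_smul, smul_apply]
    rw [← smul_neg]
    rw [one_mul] at h1
    exact h1.hasDerivWithinAt
  have hsm : ContMDiffOn 𝓘(ℝ, ℝ) (𝓡 m) ∞
      (fun t : ℝ ↦ (extChartAt (𝓡 m) c).symm (y + (t * δ) • u)) (Set.Icc 0 1) := by
    have h1 : ContMDiff 𝓘(ℝ, ℝ) 𝓘(ℝ, Model m) ∞ (fun t : ℝ ↦ y + (t * δ) • u) := by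
      rw [contMDiff_iff_contDiff]; fun_prop
    exact (contMDiffOn_extChartAt_symm c).comp h1.contMDiffOn fun t ht ↦ (hdom t ht).1
  obtain ⟨W, hW, hW0, hW1⟩ := hcov.2 _ hsm _ _ ⟨_, hpar, rfl, rfl⟩
  let ζ : ℝ → Model n := fun τ ↦ mfderiv (𝓡 n) 𝓘(ℝ, Model n) (extChartAt (𝓡 n) c')
    (f ((extChartAt (𝓡 m) c).symm (y + (τ * δ) • u))) (W τ)
  refine ⟨ζ, fun t ht ↦ ?_, ?_, ?_⟩
  · have h1 : HasDerivWithinAt ζ (-christoffelOf (metricInChart h c')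
        (coordRep m n c c' f (y + (t * δ) • u)) (derivWithin (fun τ : ℝ ↦
          coordRep m n c c' f (y + (τ * δ) • u)) (Set.Icc 0 1) t) (ζ t)) (Set.Icc 0 1) t :=
      hW t ht c' (hdom t ht).2
    have h2 : derivWithin (fun τ : ℝ ↦ coordRep m n c c' f (y + (τ * δ) • u)) (Set.Icc 0 1) t =
        δ • fderiv ℝ (coordRep m n c c' f) (y + (t * δ) • u) u := by
      have h3 := ((contDiffAt_coordRep hf (hdom t ht)).differentiableAt
        (by simp)).hasFDerivAt.comp_hasDerivAt t (hline t)
      rw [map_smul] at h3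
      exact h3.hasDerivWithinAt.derivWithin (uniqueDiffOn_Icc zero_lt_one t ht)
    rw [h2, ← christoffelL_apply, map_smul, smul_apply, ← smul_neg] at h1
    exact h1
  · have h1 := mfderiv_extChartAt_mfderiv_chartFrame hf (hdom 0 (by simp)) (ξ (0 * δ))
    exact (congrArg (mfderiv (𝓡 n) 𝓘(ℝ, Model n) (extChartAt (𝓡 n) c')
      (f ((extChartAt (𝓡 m) c).symm (y + ((0 : ℝ) * δ) • u)))) hW0).trans (h1.trans (by simp only [zero_mul, zero_smul, add_zero]; rfl))
  · have h1 := mfderiv_extChartAt_mfderiv_chartFrame hf (hdom 1 (by simp)) (ξ (1 * δ))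
    exact (congrArg (mfderiv (𝓡 n) 𝓘(ℝ, Model n) (extChartAt (𝓡 n) c')
      (f ((extChartAt (𝓡 m) c).symm (y + ((1 : ℝ) * δ) • u)))) hW1).trans (h1.trans (by simp only [one_mul]; rfl))

/-- The second fundamental form of a covariant constant map vanishes. -/
theorem christoffelDefect_of_isCovariantConstant {g : Metric m M} {h : Metric n B} {f : M → B}
    (hf : ContMDiff (𝓡 m) (𝓡 n) ∞ f) (hcov : IsCovariantConstant g h f) {c : M} {c' : B}
    {y : Model m} (hy : y ∈ coordDomain m n c c' f) (u v : Model m) :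
    christoffelDefect (metricInChart g c) (metricInChart h c') (coordRep m n c c' f) y u v = 0 := by
  -- Extend $v$ to a parallel field $\xi$ along the coordinate line through $y$ in the direction
  -- $u$. The derivative at $0$ of $\delta \mapsto DF(y + \delta u)\,\xi(\delta)$ will be computed
  -- in two ways.
  obtain ⟨ξ, hξ0, ε, hε, hξ⟩ := exists_local_solution_along_line
    ((contDiffAt_christoffelL_metricInChart g hy.1).of_le (by simp)) u v
  set F := coordRep m n c c' f with hF
  have hcont : Continuous fun t : ℝ ↦ y + t • u := by fun_prop
  have hnhds : ∀ᶠ t in 𝓝 (0 : ℝ), y + t • u ∈ coordDomain m n c c' f ∧ t ∈ Set.Ioo (-ε) ε := by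
    refine Filter.Eventually.and ?_ (Ioo_mem_nhds (by simpa using hε) hε)
    exact hcont.continuousAt.eventually_mem
      ((isOpen_coordDomain c c' hf.continuous).mem_nhds (by simpa using hy))
  obtain ⟨δ₁, hδ₁, hball⟩ := Metric.eventually_nhds_iff_ball.1 hnhds
  obtain ⟨δ₀, hδ₀, hδ₀₁⟩ := exists_between hδ₁
  have hdom : ∀ t ∈ Set.Icc (0 : ℝ) δ₀,
      y + t • u ∈ coordDomain m n c c' f ∧ t ∈ Set.Ioo (-ε) ε := by
    intro t ht
    refine hball t ?_
    rw [mem_ball_zero_iff, Real.norm_eq_abs, abs_of_nonneg ht.1]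
    exact ht.2.trans_lt hδ₀₁
  have hmul : ∀ δ ∈ Set.Icc (0 : ℝ) δ₀, ∀ t ∈ Set.Icc (0 : ℝ) 1, t * δ ∈ Set.Icc (0 : ℝ) δ₀ :=
    fun δ hδ t ht ↦ ⟨mul_nonneg ht.1 hδ.1,
      (mul_le_of_le_one_left hδ.1 ht.2).trans hδ.2⟩
  let Λ : ℝ → Model n →L[ℝ] Model n := fun s ↦
    -christoffelL (metricInChart h c') (F (y + s • u)) (fderiv ℝ F (y + s • u) u)
  have hΛ : ContinuousOn Λ (Set.Icc 0 δ₀) := by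
    intro t ht
    have hd := (hdom t ht).1
    have h1 := contDiffAt_coordRep hf hd
    have h2 : ContinuousAt (fun z ↦ christoffelL (metricInChart h c') (F z) (fderiv ℝ F z u))
        (y + t • u) :=
      ((contDiffAt_christoffelL_metricInChart h (coordRep_mem_target hd)).continuousAt.comp
        h1.continuousAt).clm_apply
        ((h1.fderiv_right (m := ∞) (by simp)).continuousAt.clm_apply continuousAt_const)
    exact (ContinuousAt.comp (f := fun t : ℝ ↦ y + t • u) h2
      hcont.continuousAt).neg.continuousWithinAt
  -- Covariant constancy controls only the end values of a transport over $[0, 1]$. Each $\delta$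
  -- therefore needs its own path, the segment from $y$ to $y + \delta u$ rescaled to unit time.
  have hex : ∀ δ ∈ Set.Icc (0 : ℝ) δ₀, ∃ ζ : ℝ → Model n,
      (∀ t ∈ Set.Icc (0 : ℝ) 1, HasDerivWithinAt ζ ((δ • Λ (t * δ)) (ζ t)) (Set.Icc 0 1) t) ∧
      ζ 0 = fderiv ℝ F y v ∧ ζ 1 = fderiv ℝ F (y + δ • u) (ξ δ) := by
    intro δ hδ
    obtain ⟨ζ, h1, h2, h3⟩ := exists_parallel_image hf hcov (c' := c') (ξ := ξ)
      (fun t ht ↦ (hdom _ (hmul δ hδ t ht)).1) (fun t ht ↦ hξ _ (hdom _ (hmul δ hδ t ht)).2)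
    exact ⟨ζ, h1, h2.trans (by rw [hξ0]), h3⟩
  have h0 : (0 : ℝ) ∈ Set.Icc 0 δ₀ := ⟨le_rfl, hδ₀.le⟩
  have hFd := contDiffAt_coordRep hf hy
  have hleft : HasDerivAt (fun δ : ℝ ↦ fderiv ℝ F (y + δ • u) (ξ δ))
      (fderiv ℝ (fderiv ℝ F) y u v +
        fderiv ℝ F y (-christoffelL (metricInChart g c) y u v)) 0 := by
    have h1 := hξ 0 (hdom 0 h0).2
    rw [zero_smul, add_zero, hξ0] at h1
    have h2 := hasDerivAt_fderiv_apply_line hFd.differentiableAt_fderiv u h1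
    rw [hξ0] at h2
    exact h2
  have hright : HasDerivWithinAt (fun δ : ℝ ↦ fderiv ℝ F (y + δ • u) (ξ δ))
      (Λ 0 (fderiv ℝ F y v)) (Set.Icc 0 δ₀) 0 :=
    hasDerivWithinAt_of_linear_ode hδ₀ hΛ hex
  -- One derivative comes from the product rule with $\xi$ parallel upstairs, the other from the
  -- transport equation in the base. Their equality is the vanishing of the defect.
  have hkey := UniqueDiffWithinAt.eq_deriv _ (uniqueDiffOn_Icc hδ₀ 0 h0) hleft.hasDerivWithinAt
    hright
  have hkey' : fderiv ℝ (fderiv ℝ F) y u v - fderiv ℝ F y (christoffelOf (metricInChart g c) y u v)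
      = -christoffelOf (metricInChart h c') (F y) (fderiv ℝ F y u) (fderiv ℝ F y v) := by
    simpa [Λ, sub_eq_add_neg, ← christoffelL_apply] using hkey
  rw [← neg_eq_zero, ← sub_eq_zero.2 hkey', christoffelDefect]
  abel

end CovariantConstant

/-! ### Chain rules for the second fundamental form and for pulled-back forms. -/

section Composition

variable {E F K : Type*} [NormedAddCommGroup E] [NormedSpace ℝ E]
  [NormedAddCommGroup F] [NormedSpace ℝ F] [NormedAddCommGroup K] [NormedSpace ℝ K]

/-- This is the composition formula $\nabla d(\Psi\circ\Phi) = d\Psi(\nabla d\Phi) + \nabla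
d\Psi(d\Phi, d\Phi)$. It follows from the second-order chain rule, because the Christoffel terms of
the middle space cancel. -/
theorem christoffelDefect_comp {GE : E → E →L[ℝ] E →L[ℝ] ℝ} {GF : F → F →L[ℝ] F →L[ℝ] ℝ}
    {GK : K → K →L[ℝ] K →L[ℝ] ℝ} {Φ : E → F} {Ψ : F → K} {Θ : E → K} {y : E}
    (hΦ : ContDiffAt ℝ ∞ Φ y) (hΨ : ContDiffAt ℝ ∞ Ψ (Φ y))
    (hΘ : Θ =ᶠ[𝓝 y] fun z ↦ Ψ (Φ z)) (u v : E) :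
    christoffelDefect GE GK Θ y u v =
      fderiv ℝ Ψ (Φ y) (christoffelDefect GE GF Φ y u v) +
      christoffelDefect GF GK Ψ (Φ y) (fderiv ℝ Φ y u) (fderiv ℝ Φ y v) := by
  have hev : ∀ᶠ z in 𝓝 y, DifferentiableAt ℝ Φ z ∧ DifferentiableAt ℝ Ψ (Φ z) := by
    have h1 : ∀ᶠ z in 𝓝 y, ContDiffAt ℝ 1 Φ z :=
      (hΦ.of_le (by simp)).eventually (by simp)
    have h2 : ∀ᶠ w in 𝓝 (Φ y), ContDiffAt ℝ 1 Ψ w := (hΨ.of_le (by simp)).eventually (by simp)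
    filter_upwards [h1, hΦ.continuousAt.eventually h2] with z hz hz'
    exact ⟨hz.differentiableAt (by simp), hz'.differentiableAt (by simp)⟩
  have hD : fderiv ℝ Θ =ᶠ[𝓝 y] fun z ↦ (fderiv ℝ Ψ (Φ z)).comp (fderiv ℝ Φ z) := by
    filter_upwards [hΘ.eventually_nhds, hev] with z hz hz'
    rw [Filter.EventuallyEq.fderiv_eq hz]
    exact fderiv_comp z hz'.2 hz'.1
  have h1 : HasFDerivAt (fun z ↦ fderiv ℝ Ψ (Φ z))
      ((fderiv ℝ (fderiv ℝ Ψ) (Φ y)).comp (fderiv ℝ Φ y)) y :=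
    HasFDerivAt.comp y hΨ.differentiableAt_fderiv.hasFDerivAt
      (hΦ.differentiableAt (by simp)).hasFDerivAt
  have h2 := (h1.clm_comp hΦ.differentiableAt_fderiv.hasFDerivAt).congr_of_eventuallyEq hD
  have h3 : fderiv ℝ (fderiv ℝ Θ) y u v =
      fderiv ℝ (fderiv ℝ Ψ) (Φ y) (fderiv ℝ Φ y u) (fderiv ℝ Φ y v) +
      fderiv ℝ Ψ (Φ y) (fderiv ℝ (fderiv ℝ Φ) y u v) := by
    rw [h2.fderiv]
    simp [add_comm]
  rw [christoffelDefect, christoffelDefect, christoffelDefect, h3, hD.self_of_nhds,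
    hΘ.self_of_nhds]
  simp only [ContinuousLinearMap.comp_apply, map_sub]
  abel

theorem fderiv_pullback_alternating {η : F → F [⋀^Fin 2]→L[ℝ] ℝ} {Φ : E → F} {y : E}
    (hη : DifferentiableAt ℝ η (Φ y)) (hΦ : ContDiffAt ℝ ∞ Φ y) (u v w : E) :
    fderiv ℝ (fun z ↦ (η (Φ z)).compContinuousLinearMap (fderiv ℝ Φ z)) y u ![v, w] =
      fderiv ℝ η (Φ y) (fderiv ℝ Φ y u) ![fderiv ℝ Φ y v, fderiv ℝ Φ y w] +
      η (Φ y) ![fderiv ℝ (fderiv ℝ Φ) y u v, fderiv ℝ Φ y w] +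
      η (Φ y) ![fderiv ℝ Φ y v, fderiv ℝ (fderiv ℝ Φ) y u w] := by
  have h1 : HasFDerivAt (fun z ↦ η (Φ z)) ((fderiv ℝ η (Φ y)).comp (fderiv ℝ Φ y)) y :=
    HasFDerivAt.comp y hη.hasFDerivAt (hΦ.differentiableAt (by simp)).hasFDerivAt
  have h2 := h1.continuousAlternatingMapCompContinuousLinearMap
    hΦ.differentiableAt_fderiv.hasFDerivAt
  rw [h2.fderiv]
  have e1 : (fun j ↦ Function.update (fun _ : Fin 2 ↦ fderiv ℝ Φ y) 0
      (fderiv ℝ (fderiv ℝ Φ) y u) j (![v, w] j)) =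
      ![fderiv ℝ (fderiv ℝ Φ) y u v, fderiv ℝ Φ y w] := by
    ext j; fin_cases j <;> simp
  have e2 : (fun j ↦ Function.update (fun _ : Fin 2 ↦ fderiv ℝ Φ y) 1
      (fderiv ℝ (fderiv ℝ Φ) y u) j (![v, w] j)) =
      ![fderiv ℝ Φ y v, fderiv ℝ (fderiv ℝ Φ) y u w] := by
    ext j; fin_cases j <;> simp
  have e3 : (fderiv ℝ Φ y : E → F) ∘ ![v, w] = ![fderiv ℝ Φ y v, fderiv ℝ Φ y w] := by
    ext j; fin_cases j <;> simp
  simp [ContinuousAlternatingMap.fderivCompContinuousLinearMap_apply, Fin.sum_univ_two, e1, e2, e3,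
    add_assoc]

theorem alternating_sub_left (η : F [⋀^Fin 2]→L[ℝ] ℝ) (a b c : F) :
    η ![a - b, c] = η ![a, c] - η ![b, c] := by
  have h := η.toMultilinearMap.cons_add ![c] (a - b) b
  rw [sub_add_cancel] at h
  exact eq_sub_of_add_eq h.symm

theorem alternating_swap (η : F [⋀^Fin 2]→L[ℝ] ℝ) (a b : F) : η ![a, b] = -η ![b, a] := by
  have h := η.toAlternatingMap.map_swap ![b, a] (i := 0) (j := 1) (by decide)
  rw [← show η.toAlternatingMap ![b, a] = η ![b, a] from rfl, ← h]
  change η _ = η _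
  congr 1
  ext j; fin_cases j <;> simp

theorem alternating_sub_right (η : F [⋀^Fin 2]→L[ℝ] ℝ) (a b c : F) :
    η ![a, b - c] = η ![a, b] - η ![a, c] := by
  rw [alternating_swap, alternating_sub_left, alternating_swap η b, alternating_swap η c]
  ring

end Composition

/-! ### Second fundamental form of the projections, and pull-back of parallel forms. -/

section Submanifolds

variable {m : ℕ} {M : Type*} [TopologicalSpace M] [ChartedSpace (Model m) M]
  [IsManifold (𝓡 m) ∞ M] {l : ℕ} {ι : Type*} [Fintype ι] {Y : ι → Type*}
  [∀ i, TopologicalSpace (Y i)] [∀ i, ChartedSpace (Model l) (Y i)]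
  [∀ i, IsManifold (𝓡 l) ∞ (Y i)]
  {n : ℕ} {B : Type*} [TopologicalSpace B] [ChartedSpace (Model n) B] [IsManifold (𝓡 n) ∞ B]

/-- Let `f i : Y i → B` be covariant constant, and let `M` with the maps `q i : M → Y i` be
infinitesimally their fibre product, with the induced metric. Then the `q i` have vanishing second
fundamental form. -/
theorem christoffelDefect_fibreProduct {gM : Metric m M} {g : ∀ i, Metric l (Y i)}
    {h : Metric n B} {q : ∀ i, M → Y i} {f : ∀ i, Y i → B} {F : M → B}
    (hq : ∀ i, ContMDiff (𝓡 m) (𝓡 l) ∞ (q i)) (hf : ∀ i, ContMDiff (𝓡 l) (𝓡 n) ∞ (f i))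
    (hfF : ∀ i x, f i (q i x) = F x)
    (hgM : ∀ p u v, gM.inner p u v = ∑ i, (g i).inner (q i p)
      (mfderiv (𝓡 m) (𝓡 l) (q i) p u) (mfderiv (𝓡 m) (𝓡 l) (q i) p v))
    (himage : ∀ (p : M) (S : ∀ i, TangentSpace (𝓡 l) (q i p)) (a : Model n),
      (∀ i, (mfderiv (𝓡 l) (𝓡 n) (f i) (q i p) (S i) : Model n) = a) →
      ∃ w : TangentSpace (𝓡 m) p, ∀ i, mfderiv (𝓡 m) (𝓡 l) (q i) p w = S i)
    (hcov : ∀ i, IsCovariantConstant (g i) h (f i)) (c : M) {y : Model m}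
    (hy : y ∈ (extChartAt (𝓡 m) c).target) (u v : Model m) (i : ι) :
    christoffelDefect (metricInChart gM c)
      (metricInChart (g i) (q i ((extChartAt (𝓡 m) c).symm y)))
      (coordRep m l c (q i ((extChartAt (𝓡 m) c).symm y)) (q i)) y u v = 0 := by
  set x := (extChartAt (𝓡 m) c).symm y with hx
  let c' : ∀ i, Y i := fun i ↦ q i x
  let Φ : ∀ i, Model m → Model l := fun i ↦ coordRep m l c (c' i) (q i)
  let Ψ : ∀ i, Model l → Model n := fun i ↦ coordRep l n (c' i) (F x) (f i)
  have hd : ∀ i, y ∈ coordDomain m l c (c' i) (q i) := fun i ↦ mem_coordDomain_self (q i) hy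
  have hdF : y ∈ coordDomain m n c (F x) F := mem_coordDomain_self F hy
  have hsymm : ∀ i, (extChartAt (𝓡 l) (c' i)).symm (Φ i y) = q i x :=
    fun i ↦ extChartAt_symm_coordRep (hd i)
  have hd' : ∀ i, Φ i y ∈ coordDomain l n (c' i) (F x) (f i) := fun i ↦
    ⟨coordRep_mem_target (hd i), by rw [hsymm, hfF]; exact mem_extChartAt_source _⟩
  have hΦ : ∀ i, ContDiffAt ℝ ∞ (Φ i) y := fun i ↦ contDiffAt_coordRep (hq i) (hd i)
  have hΨ : ∀ i, ContDiffAt ℝ ∞ (Ψ i) (Φ i y) := fun i ↦ contDiffAt_coordRep (hf i) (hd' i)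
  have hcomp : ∀ i, coordRep m n c (F x) F =ᶠ[𝓝 y] fun z ↦ Ψ i (Φ i z) := by
    intro i
    filter_upwards [(isOpen_coordDomain c (c' i) (hq i).continuous).mem_nhds (hd i)] with z hz
    have h1 := extChartAt_symm_coordRep hz
    simp only [Ψ, Φ, coordRep] at h1 ⊢
    rw [h1, hfF]
  let S : ∀ i, Model l := fun i ↦
    christoffelDefect (metricInChart gM c) (metricInChart (g i) (c' i)) (Φ i) y u v
  -- In the composition formula the term of $f_i$ vanishes, so all $S_i$ have the same image in the
  -- base, namely the defect of `F`.
  have hS : ∀ i, fderiv ℝ (Ψ i) (Φ i y) (S i) = christoffelDefect (metricInChart gM c)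
      (metricInChart h (F x)) (coordRep m n c (F x) F) y u v := by
    intro i
    rw [christoffelDefect_comp (GF := metricInChart (g i) (c' i)) (hΦ i) (hΨ i) (hcomp i) u v,
      christoffelDefect_of_isCovariantConstant (hf i) (hcov i) (hd' i), add_zero]
  -- A family with a common image in the base is tangent to the fibre product.
  have hw : ∃ w : Model m, ∀ i, fderiv ℝ (Φ i) y w = S i := by
    obtain ⟨w', hw'⟩ := himage x (fun i ↦ chartFrame l (c' i) (Φ i y) (S i))
      (chartFrame n (F x) (coordRep m n c (F x) F y) (christoffelDefect (metricInChart gM c)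
        (metricInChart h (F x)) (coordRep m n c (F x) F) y u v)) (by
        intro i
        have h1 := chartFrame_fderiv_coordRep (hf i) (hd' i) (S i)
        have h2 : coordRep m n c (F x) F y = coordRep l n (c' i) (F x) (f i) (Φ i y) :=
          (hcomp i).self_of_nhds
        rw [h2, ← hS i]
        refine Eq.trans ?_ h1.symm
        rw [hsymm])
    obtain ⟨w, rfl⟩ := chartFrame_surjective hy w'
    refine ⟨w, fun i ↦ chartFrame_injective (coordRep_mem_target (hd i)) ?_⟩
    exact (chartFrame_fderiv_coordRep (hq i) (hd i) w).trans (hw' i)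
  obtain ⟨w, hw⟩ := hw
  have hmet : ∀ u v, ∀ᶠ z in 𝓝 y, metricInChart gM c z u v =
      ∑ i, metricInChart (g i) (c' i) (Φ i z) (fderiv ℝ (Φ i) z u) (fderiv ℝ (Φ i) z v) := by
    intro u v
    have hall : ∀ᶠ z in 𝓝 y, ∀ i, z ∈ coordDomain m l c (c' i) (q i) :=
      Filter.eventually_all.2 fun i ↦
        (isOpen_coordDomain c (c' i) (hq i).continuous).mem_nhds (hd i)
    filter_upwards [hall] with z hz
    rw [metricInChart_apply, hgM]
    refine Finset.sum_congr rfl fun i _ ↦ ?_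
    have h1 := bilinInChart_pullback (g i).inner (hq i) (hz i)
    exact DFunLike.congr_fun (DFunLike.congr_fun h1 u) v
  -- Normality, tested against the vector `w` that represents the family itself, says that the sum
  -- of the squared lengths of the $S_i$ is zero.
  have hsum := sum_metric_christoffelDefect (isInvertible_metricInChart gM hy)
    ((contDiffAt_metricInChart gM hy).differentiableAt (by simp))
    (fun i ↦ isInvertible_metricInChart (g i) (coordRep_mem_target (hd i)))
    (fun i ↦ (contDiffAt_metricInChart (g i) (coordRep_mem_target (hd i))).differentiableAt
      (by simp)) (fun i ↦ metricInChart_symm (g i) (c' i)) hΦ hmet u v w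
  have hnn : ∀ i, 0 ≤ metricInChart (g i) (c' i) (Φ i y) (S i) (fderiv ℝ (Φ i) y w) := by
    intro i
    rw [hw]
    by_cases h0 : S i = 0
    · simp [h0]
    · exact (metricInChart_pos (g i) (coordRep_mem_target (hd i)) h0).le
  have hzero := (Finset.sum_eq_zero_iff_of_nonneg fun i _ ↦ hnn i).1 hsum i (Finset.mem_univ i)
  by_contra hne
  rw [hw i] at hzero
  exact (metricInChart_pos (g i) (coordRep_mem_target (hd i)) hne).ne' hzero

/-- The pull-back of a parallel form along a map with vanishing second fundamental form is
parallel. -/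
theorem IsParallelForm.smul_pullback {N : Type*} [TopologicalSpace N] [ChartedSpace (Model l) N]
    [IsManifold (𝓡 l) ∞ N] {gM : Metric m M} {g : Metric l N} {η : FormField l N 2}
    (hη : IsParallelForm g η) (hs : η.IsSmooth) {φ : M → N} (hφ : ContMDiff (𝓡 m) (𝓡 l) ∞ φ)
    (hdef : ∀ (c : M) (y : Model m), y ∈ (extChartAt (𝓡 m) c).target → ∀ u v,
      christoffelDefect (metricInChart gM c)
        (metricInChart g (φ ((extChartAt (𝓡 m) c).symm y)))
        (coordRep m l c (φ ((extChartAt (𝓡 m) c).symm y)) φ) y u v = 0) (r : ℝ) :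
    IsParallelForm gM (r • η.pullback (m := m) φ) := by
  intro c y hy u v w
  have hd := mem_coordDomain_self (l := l) φ hy
  set c' := φ ((extChartAt (𝓡 m) c).symm y)
  set Φ := coordRep m l c c' φ with hΦdef
  have hΦ : ContDiffAt ℝ ∞ Φ y := contDiffAt_coordRep hφ hd
  have hsm := hs.contDiffAt (coordRep_mem_target hd)
  have hev := η.inChart_pullback_eventuallyEq hφ hd
  have hsmul : (r • η.pullback (m := m) φ).inChart c =
      fun z ↦ r • (η.pullback (m := m) φ).inChart c z := rfl
  have hdiff : DifferentiableAt ℝ ((η.pullback (m := m) φ).inChart c) y :=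
    ((hs.pullback hφ).contDiffAt hy).differentiableAt (by simp)
  have hder : fderiv ℝ ((r • η.pullback (m := m) φ).inChart c) y u ![v, w] =
      r * (fderiv ℝ (η.inChart c') (Φ y) (fderiv ℝ Φ y u) ![fderiv ℝ Φ y v, fderiv ℝ Φ y w] +
      η.inChart c' (Φ y) ![fderiv ℝ (fderiv ℝ Φ) y u v, fderiv ℝ Φ y w] +
      η.inChart c' (Φ y) ![fderiv ℝ Φ y v, fderiv ℝ (fderiv ℝ Φ) y u w]) := by
    rw [← fderiv_pullback_alternating (hsm.differentiableAt (by simp)) hΦ, hsmul,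
      fderiv_fun_const_smul hdiff, hev.fderiv_eq]
    rfl
  have hval : ∀ a b, (r • η.pullback (m := m) φ).inChart c y ![a, b] =
      r * η.inChart c' (Φ y) ![fderiv ℝ Φ y a, fderiv ℝ Φ y b] := by
    intro a b
    have e3 : (fderiv ℝ Φ y : Model m → Model l) ∘ ![a, b] =
        ![fderiv ℝ Φ y a, fderiv ℝ Φ y b] := by
      ext j; fin_cases j <;> simp
    have h0 := hev.self_of_nhds
    change r * ((η.pullback (m := m) φ).inChart c y ![a, b]) = _
    rw [h0, ← e3]
    rfl
  have hΓ : ∀ a, fderiv ℝ Φ y (christoffel gM c y u a) =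
      christoffel g c' (Φ y) (fderiv ℝ Φ y u) (fderiv ℝ Φ y a) +
        fderiv ℝ (fderiv ℝ Φ) y u a := by
    intro a
    have h1 := hdef c y hy u a
    rw [christoffelDefect, sub_sub, sub_eq_zero] at h1
    exact h1
  have hpar := hη c' (Φ y) (coordRep_mem_target hd) (fderiv ℝ Φ y u) (fderiv ℝ Φ y v)
    (fderiv ℝ Φ y w)
  have e1 := alternating_sub_left (η.inChart c' (Φ y)) (fderiv ℝ Φ y (christoffel gM c y u v))
    (fderiv ℝ (fderiv ℝ Φ) y u v) (fderiv ℝ Φ y w)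
  have e2 := alternating_sub_right (η.inChart c' (Φ y)) (fderiv ℝ Φ y v)
    (fderiv ℝ Φ y (christoffel gM c y u w)) (fderiv ℝ (fderiv ℝ Φ) y u w)
  -- Writing $\Gamma(D\Phi u, D\Phi a)$ as $D\Phi\,\Gamma(u,a) - D^2\Phi(u,a)$ turns the parallelism
  -- of $\eta$ into that of the pull-back: the second derivatives are those in `hder`.
  rw [eq_sub_of_add_eq (hΓ v).symm, eq_sub_of_add_eq (hΓ w).symm, e1, e2] at hpar
  rw [hder, hval, hval]
  linear_combination r * hpar

end Submanifolds

/-! ### Standard bases of fibre products of Hermitian spaces. -/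

section LinearAlgebra

theorem exists_orthonormal_basis_of_pos {n : ℕ} {W : Type*} [AddCommGroup W] [Module ℝ W]
    [FiniteDimensional ℝ W] (hn : Module.finrank ℝ W = n) (h : W →ₗ[ℝ] W →ₗ[ℝ] ℝ)
    (hsymm : ∀ u v, h u v = h v u) (hpos : ∀ u, u ≠ 0 → 0 < h u u) :
    ∃ e : Module.Basis (Fin n) ℝ W, ∀ k l, h (e k) (e l) = if k = l then 1 else 0 := by
  let c : InnerProductSpace.Core ℝ W :=
    { inner := fun u v ↦ h u v
      conj_inner_symm := fun u v ↦ hsymm v u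
      re_inner_nonneg := fun u ↦ by
        by_cases hu : u = 0
        · simp [hu]
        · exact (hpos u hu).le
      add_left := fun u v w ↦ by simp
      smul_left := fun u v r ↦ by simp
      definite := fun u hu ↦ by
        by_contra hne
        exact (hpos u hne).ne' hu }
  let _ := c.toNormedAddCommGroup
  let _ : InnerProductSpace ℝ W := InnerProductSpace.ofCore c.toCore
  let e := (stdOrthonormalBasis ℝ W).reindex (finCongr hn)
  refine ⟨e.toBasis, fun k l ↦ ?_⟩
  have h1 := orthonormal_iff_ite.1 e.orthonormal k l
  rw [← h1, OrthonormalBasis.coe_toBasis]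
  rfl

/-- A compatible family in a space which is infinitesimally a fibre product comes from a vector. -/
theorem exists_common_lift {n s : ℕ} {T W : Type*} {V : Fin s → Type*} [AddCommGroup T]
    [Module ℝ T] [AddCommGroup W] [Module ℝ W] [∀ i, AddCommGroup (V i)] [∀ i, Module ℝ (V i)]
    [FiniteDimensional ℝ T] [FiniteDimensional ℝ W] [∀ i, FiniteDimensional ℝ (V i)]
    (hs : 1 ≤ s) (hT : Module.finrank ℝ T = n * (s + 1)) (hW : Module.finrank ℝ W = n)
    (hV : ∀ i, Module.finrank ℝ (V i) = 2 * n)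
    (P : ∀ i, T →ₗ[ℝ] V i) (A : ∀ i, V i →ₗ[ℝ] W) (hP : ∀ t, (∀ i, P i t = 0) → t = 0)
    (hA : ∀ i, Function.Surjective (A i)) (hAP : ∀ i j t, A i (P i t) = A j (P j t))
    (S : ∀ i, V i) (a : W) (hS : ∀ i, A i (S i) = a) : ∃ t, ∀ i, P i t = S i := by
  -- The kernel consists of the families with a common image, recorded together with that image. As
  -- `D` is onto, its kernel has dimension $2ns + n - ns = n(s+1)$, that of `T`, and an injection of
  -- `T` into it is bijective.
  let D : ((∀ i, V i) × W) →ₗ[ℝ] (Fin s → W) :=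
    LinearMap.pi fun i ↦ (A i ∘ₗ LinearMap.proj i) ∘ₗ LinearMap.fst ℝ _ _ - LinearMap.snd ℝ _ _
  have hD : ∀ q i, D q i = A i (q.1 i) - q.2 := fun q i ↦ rfl
  have hDsurj : Function.Surjective D := by
    intro r
    choose u hu using fun i ↦ hA i (r i)
    exact ⟨(u, 0), funext fun i ↦ by simp [hD, hu]⟩
  let i₀ : Fin s := ⟨0, hs⟩
  let Q : T →ₗ[ℝ] LinearMap.ker D := LinearMap.codRestrict _
    ((LinearMap.pi P).prod (A i₀ ∘ₗ P i₀)) fun t ↦ by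
      rw [LinearMap.mem_ker]
      ext i
      simp [hD, hAP i i₀ t]
  have hQ : Function.Injective Q := by
    rw [← LinearMap.ker_eq_bot, LinearMap.ker_eq_bot']
    intro t ht
    refine hP t fun i ↦ ?_
    exact congrFun (congrArg (fun q ↦ q.1.1) ht) i
  have hfin : Module.finrank ℝ T = Module.finrank ℝ (LinearMap.ker D) := by
    have h1 := D.finrank_range_add_finrank_ker
    rw [LinearMap.range_eq_top.2 hDsurj, finrank_top, Module.finrank_prod,
      Module.finrank_pi_fintype, Module.finrank_pi_fintype] at h1
    simp only [hV, hW, Finset.sum_const, Finset.card_univ, Fintype.card_fin, smul_eq_mul] at h1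
    rw [hT]
    nlinarith
  obtain ⟨t, ht⟩ := (LinearMap.injective_iff_surjective_of_finrank_eq_finrank hfin).1 hQ
    ⟨(S, a), by rw [LinearMap.mem_ker]; ext i; simp [hD, hS]⟩
  exact ⟨t, fun i ↦ congrFun (congrArg (fun q ↦ q.1.1) ht) i⟩

variable {V : Type*} [NormedAddCommGroup V] [NormedSpace ℝ V]

theorem alternating_add_left (η : V [⋀^Fin 2]→L[ℝ] ℝ) (a b c : V) :
    η ![a + b, c] = η ![a, c] + η ![b, c] :=
  η.toMultilinearMap.cons_add ![c] a b

theorem alternating_smul_left (η : V [⋀^Fin 2]→L[ℝ] ℝ) (r : ℝ) (a c : V) :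
    η ![r • a, c] = r * η ![a, c] :=
  η.toMultilinearMap.cons_smul ![c] r a

/-- The bilinear map underlying an alternating form of degree two. -/
def alternatingBilin (η : V [⋀^Fin 2]→L[ℝ] ℝ) : V →ₗ[ℝ] V →ₗ[ℝ] ℝ :=
  LinearMap.mk₂ ℝ (fun a b ↦ η ![a, b]) (alternating_add_left η) (alternating_smul_left η)
    (fun a b c ↦ by
      rw [alternating_swap, alternating_add_left, alternating_swap η b, alternating_swap η c]
      ring)
    (fun r a b ↦ by
      rw [alternating_swap, alternating_smul_left, alternating_swap η b]
      simp)

theorem alternatingBilin_apply (η : V [⋀^Fin 2]→L[ℝ] ℝ) (a b : V) :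
    alternatingBilin η a b = η ![a, b] := rfl

/-- Vectors whose mutual products are those of a standard basis form a standard basis. -/
theorem exists_isStandardBasis {n s : ℕ} [FiniteDimensional ℝ V] (hs : 1 ≤ s)
    (hV : Module.finrank ℝ V = n * (s + 1)) (η : Fin s → V [⋀^Fin 2]→L[ℝ] ℝ)
    (v : Fin n → V) (w : Fin s → Fin n → V) (hvv : ∀ j k l, η j ![v k, v l] = 0)
    (hvw : ∀ j i k l, η j ![v k, w i l] = if j = i ∧ k = l then 1 else 0)
    (hww : ∀ j i i' k l, η j ![w i k, w i' l] = 0) :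
    ∃ b : Module.Basis (Fin n ⊕ Fin s × Fin n) ℝ V, IsStandardBasis η b ∧
      (∀ k, b (.inl k) = v k) ∧ ∀ i k, b (.inr (i, k)) = w i k := by
  have hwv : ∀ j i k l, η j ![w i l, v k] = -if j = i ∧ k = l then 1 else 0 := fun j i k l ↦ by
    rw [alternating_swap, hvw]
  have hli : LinearIndependent ℝ (Sum.elim v fun q : Fin s × Fin n ↦ w q.1 q.2) := by
    rw [Fintype.linearIndependent_iff]
    intro c hc
    rw [Fintype.sum_sum_type] at hc
    simp only [Sum.elim_inl, Sum.elim_inr] at hc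
    have key : ∀ j x, ∑ k, c (.inl k) * η j ![v k, x] +
        ∑ q : Fin s × Fin n, c (.inr q) * η j ![w q.1 q.2, x] = 0 := by
      intro j x
      have h1 := congrArg (fun u ↦ alternatingBilin (η j) u x) hc
      simpa [map_add, map_sum, alternatingBilin_apply] using h1
    -- Pairing a relation with $w^j_k$ under $\eta_j$ isolates the coefficient of $v_k$. One index
    -- $j$ suffices, and it exists because $s \ge 1$. Pairing with $v_l$ under $\eta_j$ then
    -- isolates the coefficient of $w^j_l$.
    have hinl : ∀ k, c (.inl k) = 0 := by
      intro k
      have h1 := key ⟨0, hs⟩ (w ⟨0, hs⟩ k)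
      simpa [hvw, hww] using h1
    rintro (k | ⟨j, l⟩)
    · exact hinl k
    · have h1 := key j (v l)
      simpa [hvv, hwv, Fintype.sum_prod_type, ite_and] using h1
  have hcard : Fintype.card (Fin n ⊕ Fin s × Fin n) = Module.finrank ℝ V := by
    simp [hV]; ring
  let b := basisOfLinearIndependentOfCardEqFinrank' _ hli hcard
  have hb : ∀ a, b a = Sum.elim v (fun q : Fin s × Fin n ↦ w q.1 q.2) a := fun a ↦ by simp [b]
  refine ⟨b, fun j x y ↦ ?_, fun k ↦ by simp [hb], fun i k ↦ by simp [hb]⟩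
  let β : V →ₗ[ℝ] V →ₗ[ℝ] ℝ := ∑ i : Fin n,
    ((b.coord (.inl i)).smulRight (b.coord (.inr (j, i))) -
      (b.coord (.inr (j, i))).smulRight (b.coord (.inl i)))
  have hβ : ∀ x y, β x y = ∑ i : Fin n, (b.coord (.inl i) x * b.coord (.inr (j, i)) y
      - b.coord (.inl i) y * b.coord (.inr (j, i)) x) := by
    intro x y
    simp only [β, LinearMap.sum_apply, LinearMap.sub_apply, LinearMap.smulRight_apply,
      LinearMap.smul_apply, smul_eq_mul]
    exact Finset.sum_congr rfl fun i _ ↦ by ring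
  rw [← hβ, ← alternatingBilin_apply]
  refine DFunLike.congr_fun (DFunLike.congr_fun (b.ext fun a ↦ b.ext fun a' ↦ ?_) x) y
  simp only [hβ, alternatingBilin_apply, Module.Basis.coord_apply, Module.Basis.repr_self]
  rw [hb, hb]
  rcases a with k | ⟨i, k⟩ <;> rcases a' with l | ⟨i', l⟩ <;>
    simp [hvv, hvw, hwv, hww, Finsupp.single_apply, ite_and, eq_comm]

/-- Lagrangian splitting of a Hermitian vector space adapted to a surjection with Lagrangian
kernel. -/
theorem exists_adapted_family {n : ℕ} [FiniteDimensional ℝ V] {W : Type*} [AddCommGroup W]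
    [Module ℝ W] (hV : Module.finrank ℝ V = 2 * n) (e : Module.Basis (Fin n) ℝ W)
    (η : V [⋀^Fin 2]→L[ℝ] ℝ) (J : V → V) (g : V →ₗ[ℝ] V →ₗ[ℝ] ℝ)
    (hsymm : ∀ u v, g u v = g v u) (hpos : ∀ u, u ≠ 0 → 0 < g u u)
    (hJ : ∀ v, J (J v) = -v) (hg : ∀ u v, g u v = η ![u, J v]) (A : V →ₗ[ℝ] W)
    (hA : Function.Surjective A) (hlag : ∀ u v, A u = 0 → A v = 0 → η ![u, v] = 0) :
    ∃ v w : Fin n → V, (∀ k, A (v k) = e k) ∧ (∀ k, A (w k) = 0) ∧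
      (∀ k l, η ![v k, v l] = 0) ∧ (∀ k l, η ![v k, w l] = if k = l then 1 else 0) ∧
      (∀ k u, A u = 0 → g (v k) u = 0) ∧
      ((∀ k l, g (v k) (v l) = if k = l then 1 else 0) →
        ∀ k l, g (w k) (w l) = if k = l then 1 else 0) := by
  have hη : ∀ u v, η ![u, v] = -g u (J v) := by
    intro u v
    have h1 := map_neg (alternatingBilin η u) v
    rw [hg, hJ, ← alternatingBilin_apply η u (-v), h1, alternatingBilin_apply, neg_neg]
  have hJg : ∀ u v, g (J u) v = -g u (J v) := by
    intro u v
    rw [← hη, alternating_swap, hη, neg_neg, hsymm]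
  have hJJ : ∀ u v, g (J u) (J v) = g u v := fun u v ↦ by rw [hJg, hJ, map_neg, neg_neg]
  have hnd : ∀ u, (∀ x, g u x = 0) → u = 0 := by
    intro u hu
    by_contra hne
    exact (hpos u hne).ne' (hu u)
  -- Linearity of `J` need not be assumed: it follows from skewness with respect to the
  -- nondegenerate form `g`.
  let Jl : V →ₗ[ℝ] V :=
    { toFun := J
      map_add' := fun u v ↦ sub_eq_zero.1 (hnd _ fun x ↦ by
        rw [map_sub, map_add, LinearMap.sub_apply, LinearMap.add_apply, hJg, hJg, hJg, map_add,
          LinearMap.add_apply]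
        ring)
      map_smul' := fun r u ↦ sub_eq_zero.1 (hnd _ fun x ↦ by
        simp [hJg]) }
  have hhor : ∀ u w, A u = 0 → A w = 0 → g (J u) w = 0 := by
    intro u w hu hw
    rw [hJg, ← hη, hlag u w hu hw]
  have hker : Module.finrank ℝ (LinearMap.ker A) = n := by
    have h1 := A.finrank_range_add_finrank_ker
    rw [LinearMap.range_eq_top.2 hA, finrank_top, Module.finrank_eq_card_basis e,
      Fintype.card_fin, hV] at h1
    omega
  -- Since `J` maps the Lagrangian kernel to its orthogonal complement, $A \circ J$ is injective on
  -- the kernel. By dimension it is an isomorphism onto `W`, so each basis vector has a unique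
  -- horizontal lift `J (q k)`.
  have hinj : ∀ u, A u = 0 → A (J u) = 0 → u = 0 := by
    intro u hu hu'
    by_contra hne
    exact (hpos u hne).ne' ((hJJ u u).symm.trans (hhor u (J u) hu hu'))
  have : FiniteDimensional ℝ W := e.finiteDimensional_of_finite
  let Q : LinearMap.ker A →ₗ[ℝ] W := (A ∘ₗ Jl).domRestrict (LinearMap.ker A)
  have hQinj : Function.Injective Q := by
    rw [← LinearMap.ker_eq_bot, LinearMap.ker_eq_bot']
    intro u hu
    exact Subtype.ext (hinj u u.2 hu)
  have hQsurj : Function.Surjective Q :=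
    (LinearMap.injective_iff_surjective_of_finrank_eq_finrank (by
      rw [hker, Module.finrank_eq_card_basis e, Fintype.card_fin])).1 hQinj
  choose q hq using fun k ↦ hQsurj (e k)
  have hqe : ∀ k, A (J (q k)) = e k := hq
  have hqker : ∀ k, A (q k) = 0 := fun k ↦ (q k).2
  have hvv : ∀ k l, η ![J (q k), J (q l)] = 0 := by
    intro k l
    rw [← hg]
    exact hhor _ _ (hqker k) (hqker l)
  have hvw : ∀ k w, η ![J (q k), w] = -g (q k) w := by
    intro k w
    rw [hη, hJJ]
  -- If the lifts are orthonormal, the dual vertical family is $-q_k$, which is orthonormal because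
  -- `J` is an isometry. Otherwise only a dual family is required, and the orthonormality clause
  -- holds vacuously.
  by_cases horth : ∀ k l, g (J (q k)) (J (q l)) = if k = l then 1 else 0
  · refine ⟨fun k ↦ J (q k), fun k ↦ -q k, hqe, fun k ↦ by rw [map_neg, hqker, neg_zero], hvv,
      fun k l ↦ ?_, fun k u hu ↦ hhor _ _ (hqker k) hu, fun _ k l ↦ ?_⟩
    · rw [hvw, map_neg, neg_neg, ← hJJ, horth]
    · rw [map_neg, map_neg, LinearMap.neg_apply, neg_neg, ← hJJ, horth]
  -- `R` pairs vertical vectors with the horizontal lifts under $\eta$. It is injective because the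
  -- `q k` span the kernel and `g` is definite, so preimages of unit vectors form the dual family.
  let R : LinearMap.ker A →ₗ[ℝ] (Fin n → ℝ) :=
    LinearMap.pi fun k ↦ (-g (q k)).domRestrict (LinearMap.ker A)
  have hRinj : Function.Injective R := by
    rw [← LinearMap.ker_eq_bot, LinearMap.ker_eq_bot']
    intro u hu
    have hu' : ∀ k, g (q k) u = 0 := fun k ↦ neg_eq_zero.1 (congrFun hu k)
    have hsum : u = ∑ k, e.repr (Q u) k • q k := by
      apply hQinj
      rw [map_sum]
      simp only [map_smul, hq]
      exact (e.sum_repr (Q u)).symm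
    have hsum' : (u : V) = ∑ k, e.repr (Q u) k • (q k : V) := by
      have h1 := congrArg (LinearMap.ker A).subtype hsum
      simpa using h1
    have hz : g u u = 0 := by
      nth_rewrite 1 [hsum']
      rw [map_sum, LinearMap.sum_apply]
      exact Finset.sum_eq_zero fun k _ ↦ by simp [hu']
    by_contra hne
    exact (hpos u fun h ↦ hne (Subtype.ext h)).ne' hz
  have hRsurj : Function.Surjective R :=
    (LinearMap.injective_iff_surjective_of_finrank_eq_finrank (by
      rw [hker, Module.finrank_fin_fun])).1 hRinj
  choose w hw using fun l ↦ hRsurj (Pi.single l 1)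
  refine ⟨fun k ↦ J (q k), fun l ↦ w l, hqe, fun k ↦ (w k).2, hvv, fun k l ↦ ?_,
    fun k u hu ↦ hhor _ _ (hqker k) hu, fun h ↦ (horth h).elim⟩
  rw [hvw, ← Pi.single_apply l (1 : ℝ) k]
  exact congrFun (hw l) k

/-- The standard basis of an infinitesimal fibre product of Hermitian vector spaces over a common
quotient by Lagrangian subspaces. -/
theorem exists_isStandardBasis_fibreProduct {n s : ℕ} [FiniteDimensional ℝ V] {W : Type*}
    [NormedAddCommGroup W] [NormedSpace ℝ W] {E : Fin s → Type*}
    [∀ i, NormedAddCommGroup (E i)] [∀ i, NormedSpace ℝ (E i)] [∀ i, FiniteDimensional ℝ (E i)]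
    (hs : 1 ≤ s) (hV : Module.finrank ℝ V = n * (s + 1))
    (hE : ∀ i, Module.finrank ℝ (E i) = 2 * n) (e : Module.Basis (Fin n) ℝ W)
    (η : ∀ i, (E i) [⋀^Fin 2]→L[ℝ] ℝ) (J : ∀ i, E i → E i)
    (g : ∀ i, E i →L[ℝ] E i →L[ℝ] ℝ) (gV : V → V → ℝ)
    (hsymm : ∀ i u v, g i u v = g i v u) (hpos : ∀ i u, u ≠ 0 → 0 < g i u u)
    (hJ : ∀ i v, J i (J i v) = -v) (hg : ∀ i u v, g i u v = η i ![u, J i v])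
    (A : ∀ i, E i →L[ℝ] W) (hA : ∀ i, Function.Surjective (A i))
    (hlag : ∀ i u v, A i u = 0 → A i v = 0 → η i ![u, v] = 0)
    (P : ∀ i, V →L[ℝ] E i) (hP : ∀ t, (∀ i, P i t = 0) → t = 0)
    (hAP : ∀ i j t, A i (P i t) = A j (P j t)) (hgV : ∀ u v, gV u v = ∑ i, g i (P i u) (P i v)) :
    ∃ b : Module.Basis (Fin n ⊕ Fin s × Fin n) ℝ V,
      IsStandardBasis (fun j ↦ √(s : ℝ) • (η j).compContinuousLinearMap (P j)) b ∧
      ((∀ i u v k l, (∀ w, A i w = 0 → g i u w = 0) → (∀ w, A i w = 0 → g i v w = 0) →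
          A i u = e k → A i v = e l → g i u v = if k = l then 1 else 0) →
        ∀ a a', gV (b a) (b a') = if a = a' then 1 else 0) := by
  have hs0 : (0 : ℝ) < s := by exact_mod_cast hs
  have hsq : √(s : ℝ) * √(s : ℝ) = s := Real.mul_self_sqrt hs0.le
  have hsq0 : √(s : ℝ) ≠ 0 := (Real.sqrt_pos.2 hs0).ne'
  choose v w hv hw hvv hvw hhor horth using fun i ↦ exists_adapted_family (hE i) e (η i) (J i)
    ((ContinuousLinearMap.coeLM ℝ).comp (g i).toLinearMap) (hsymm i) (hpos i) (hJ i) (hg i)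
    (A i).toLinearMap (hA i) (hlag i)
  have : FiniteDimensional ℝ W := e.finiteDimensional_of_finite
  have hW : Module.finrank ℝ W = n := by rw [Module.finrank_eq_card_basis e, Fintype.card_fin]
  have hlift := exists_common_lift hs hV hW hE (fun i ↦ (P i).toLinearMap)
    (fun i ↦ (A i).toLinearMap) hP hA hAP
  -- The factor $s^{-1/2}$ cancels the $\sqrt s$ of the forms and makes the $s$ components add up to
  -- a unit vector in the orthonormal case.
  choose x hx using fun k ↦ hlift (fun i ↦ (√(s : ℝ))⁻¹ • v i k) ((√(s : ℝ))⁻¹ • e k)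
    fun i ↦ by rw [map_smul, hv]
  -- A vertical vector in a single slot is tangent to the fibre product because all its components
  -- map to zero in `W`.
  choose z hz using fun j l ↦ hlift (fun i ↦ if i = j then w i l else 0) 0 fun i ↦ by
    split_ifs
    · exact hw i l
    · exact map_zero _
  have hx' : ∀ k i, P i (x k) = (√(s : ℝ))⁻¹ • v i k := hx
  have hz' : ∀ j l i, P i (z j l) = if i = j then w i l else 0 := hz
  have hcomp : ∀ j a b, (√(s : ℝ) • (η j).compContinuousLinearMap (P j)) ![a, b] =
      √(s : ℝ) * alternatingBilin (η j) (P j a) (P j b) := by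
    intro j a b
    rw [alternatingBilin_apply]
    change √(s : ℝ) * (η j) ((P j) ∘ ![a, b]) = _
    congr 2
    ext i; fin_cases i <;> rfl
  obtain ⟨b, hb, hbv, hbw⟩ := exists_isStandardBasis hs hV
    (fun j ↦ √(s : ℝ) • (η j).compContinuousLinearMap (P j)) x z
    (fun j k l ↦ by
      rw [hcomp, hx', hx']
      simp [alternatingBilin_apply, hvv])
    (fun j i k l ↦ by
      rw [hcomp, hx', hz']
      by_cases hji : j = i
      · subst hji
        simp [alternatingBilin_apply, hvw, hsq0]
      · rw [if_neg hji, map_zero, mul_zero, if_neg fun h ↦ hji h.1])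
    (fun j i i' k l ↦ by
      rw [hcomp, hz', hz']
      by_cases hji : j = i
      · by_cases hji' : j = i'
        · rw [if_pos hji, if_pos hji', alternatingBilin_apply, hlag _ _ _ (hw _ _) (hw _ _),
            mul_zero]
        · rw [if_neg hji', map_zero, mul_zero]
      · rw [if_neg hji, map_zero, LinearMap.zero_apply, mul_zero])
  refine ⟨b, hb, fun hR ↦ ?_⟩
  have hgvv : ∀ i k l, g i (v i k) (v i l) = if k = l then 1 else 0 := fun i k l ↦
    hR i _ _ k l (hhor i k) (hhor i l) (hv i k) (hv i l)
  have hgww : ∀ i k l, g i (w i k) (w i l) = if k = l then 1 else 0 := fun i ↦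
    horth i (hgvv i)
  have hgvw : ∀ i k l, g i (v i k) (w i l) = 0 := fun i k l ↦ hhor i k _ (hw i l)
  have hgV' : ∀ u v, gV u v = gV v u := fun u v ↦ by
    rw [hgV, hgV]
    exact Finset.sum_congr rfl fun i _ ↦ hsymm i _ _
  have h1 : ∀ k l, gV (x k) (x l) = if k = l then 1 else 0 := by
    intro k l
    rw [hgV]
    simp only [hx', map_smul, _root_.smul_apply, hgvv, Finset.sum_const,
      Finset.card_univ, Fintype.card_fin, smul_eq_mul, nsmul_eq_mul]
    rw [← mul_assoc (√(s : ℝ))⁻¹, ← mul_inv, hsq, ← mul_assoc, mul_inv_cancel₀ hs0.ne', one_mul]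
  have h2 : ∀ k j l, gV (x k) (z j l) = 0 := by
    intro k j l
    rw [hgV]
    refine Finset.sum_eq_zero fun i _ ↦ ?_
    rw [hx', hz']
    split_ifs <;> simp [hgvw]
  have h3 : ∀ j k j' l, gV (z j k) (z j' l) = if j = j' ∧ k = l then 1 else 0 := by
    intro j k j' l
    rw [hgV, Finset.sum_eq_single j]
    · rw [hz', hz', if_pos rfl]
      by_cases hjj : j = j' <;> simp [hjj, hgww]
    · intro i _ hi
      rw [hz', if_neg hi]
      simp
    · simp
  rintro (k | ⟨j, k⟩) (l | ⟨j', l⟩)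
  · rw [hbv, hbv, h1]; simp
  · rw [hbv, hbw, h2]; simp
  · rw [hbv, hbw, hgV', h2]; simp
  · rw [hbw, hbw, h3]; simp

end LinearAlgebra

/-! ### Local form of submersions. -/

section Submersion

variable {k n r : ℕ} {M : Type*} [TopologicalSpace M] [ChartedSpace (Model k) M]
  {B : Type*} [TopologicalSpace B] [ChartedSpace (Model n) B]

/-- A submersion comes with some model space for its fibres. Comparing dimensions identifies it with
`Model r`, so that one model serves all factors. -/
theorem isSubmersionAtOfComplement_model (hk : k = n + r) {f : M → B}
    (hf : Manifold.IsSubmersion (𝓡 k) (𝓡 n) ∞ f) (x : M) :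
    Manifold.IsSubmersionAtOfComplement (Model r) (𝓡 k) (𝓡 n) ∞ f x := by
  obtain ⟨F, _, _, hF⟩ := hf
  have L := (hF x).equiv
  have hfin : FiniteDimensional ℝ F :=
    FiniteDimensional.of_injective (L.symm.toLinearMap ∘ₗ LinearMap.inr ℝ (Model n) F)
      (L.symm.injective.comp (Prod.mk_right_injective 0))
  have h1 := L.toLinearEquiv.finrank_eq
  rw [Module.finrank_prod, finrank_euclideanSpace_fin, finrank_euclideanSpace_fin] at h1
  exact (hF x).trans_F (ContinuousLinearEquiv.ofFinrankEq (by
    rw [finrank_euclideanSpace_fin]; omega))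

/-- Adapted to a submersion and to a chart of its base, there are charts in which the submersion is
the first projection. -/
theorem exists_adapted_chart [IsManifold (𝓡 k) ∞ M] [IsManifold (𝓡 n) ∞ B] (hk : k = n + r)
    {f : M → B} (hf : Manifold.IsSubmersion (𝓡 k) (𝓡 n) ∞ f) (x : M)
    {ψ : OpenPartialHomeomorph B (Model n)} (hψ : ψ ∈ IsManifold.maximalAtlas (𝓡 n) ∞ B)
    (hx : f x ∈ ψ.source) :
    ∃ φ : OpenPartialHomeomorph M (Model n × Model r), x ∈ φ.source ∧
      ContMDiffOn (𝓡 k) 𝓘(ℝ, Model n × Model r) ∞ φ φ.source ∧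
      ContMDiffOn 𝓘(ℝ, Model n × Model r) (𝓡 k) ∞ φ.symm φ.target ∧
      ∀ z ∈ φ.source, f z ∈ ψ.source ∧ (φ z).1 = ψ (f z) := by
  have h := isSubmersionAtOfComplement_model hk hf x
  set φ₀ := h.domChart
  set ψ₀ := h.codChart
  let φ₁ : OpenPartialHomeomorph M (Model n × Model r) :=
    φ₀.trans h.equiv.toHomeomorph.toOpenPartialHomeomorph
  -- The submersion brings its own base chart `ψ₀`. Applying the transition to `ψ` on the first
  -- factor allows several submersions to share one prescribed base chart.
  let τ : OpenPartialHomeomorph (Model n) (Model n) := ψ₀.symm.trans ψ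
  let σ : OpenPartialHomeomorph (Model n × Model r) (Model n × Model r) :=
    τ.prod (OpenPartialHomeomorph.refl (Model r))
  have hφ₁s : φ₁.source = φ₀.source := by ext z; simp [φ₁]
  have hφ₁ : ∀ z ∈ φ₀.source, (φ₁ z).1 = ψ₀ (f z) := by
    intro z hz
    have h1 := h.writtenInCharts (show φ₀ z ∈ (φ₀.extend (𝓡 k)).target by
      simpa using φ₀.map_source hz)
    simp only [Function.comp_apply, OpenPartialHomeomorph.extend_coe,
      OpenPartialHomeomorph.extend_coe_symm] at h1
    have h2 : φ₀.symm ((𝓡 k).symm (φ₀ z)) = z := φ₀.left_inv hz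
    rw [h2] at h1
    exact h1.symm
  have hψ₀ : ∀ z ∈ φ₀.source, f z ∈ ψ₀.source := fun z hz ↦ h.source_subset_preimage_source hz
  have hτ : ContMDiffOn 𝓘(ℝ, Model n) 𝓘(ℝ, Model n) ∞ τ τ.source := by
    refine (contMDiffOn_of_mem_maximalAtlas hψ).comp
      ((contMDiffOn_symm_of_mem_maximalAtlas h.codChart_mem_maximalAtlas).mono ?_) ?_
    · exact fun z hz ↦ hz.1
    · exact fun z hz ↦ hz.2
  have hτ' : ContMDiffOn 𝓘(ℝ, Model n) 𝓘(ℝ, Model n) ∞ τ.symm τ.target := by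
    refine (contMDiffOn_of_mem_maximalAtlas h.codChart_mem_maximalAtlas).comp
      ((contMDiffOn_symm_of_mem_maximalAtlas hψ).mono ?_) ?_
    · exact fun z hz ↦ hz.1
    · exact fun z hz ↦ hz.2
  have hσ : ContMDiffOn 𝓘(ℝ, Model n × Model r) 𝓘(ℝ, Model n × Model r) ∞ σ σ.source := by
    rw [contMDiffOn_iff_contDiffOn] at hτ ⊢
    exact (hτ.comp contDiffOn_fst fun z hz ↦ hz.1).prodMk contDiffOn_snd
  have hσ' : ContMDiffOn 𝓘(ℝ, Model n × Model r) 𝓘(ℝ, Model n × Model r) ∞ σ.symm σ.target := by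
    rw [contMDiffOn_iff_contDiffOn] at hτ' ⊢
    exact (hτ'.comp contDiffOn_fst fun z hz ↦ hz.1).prodMk contDiffOn_snd
  have hφ₁sm : ContMDiffOn (𝓡 k) 𝓘(ℝ, Model n × Model r) ∞ φ₁ φ₁.source := by
    rw [hφ₁s]
    exact h.equiv.contDiff.contMDiff.comp_contMDiffOn
      (contMDiffOn_of_mem_maximalAtlas h.domChart_mem_maximalAtlas)
  have hφ₁sm' : ContMDiffOn 𝓘(ℝ, Model n × Model r) (𝓡 k) ∞ φ₁.symm φ₁.target := by
    refine (contMDiffOn_symm_of_mem_maximalAtlas h.domChart_mem_maximalAtlas).comp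
      h.equiv.symm.contDiff.contMDiff.contMDiffOn ?_
    exact fun z hz ↦ hz.2
  refine ⟨φ₁.trans σ, ?_, ?_, ?_, ?_⟩
  · have hx₀ := h.mem_domChart_source
    refine ⟨show x ∈ φ₁.source from hφ₁s ▸ hx₀, ⟨?_, trivial⟩⟩
    change (φ₁ x).1 ∈ ψ₀.target ∩ ψ₀.symm ⁻¹' ψ.source
    rw [hφ₁ x hx₀]
    refine ⟨ψ₀.map_source (hψ₀ x hx₀), ?_⟩
    rw [Set.mem_preimage, ψ₀.left_inv (hψ₀ x hx₀)]
    exact hx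
  · exact hσ.comp (hφ₁sm.mono fun z hz ↦ hz.1) fun z hz ↦ hz.2
  · exact hφ₁sm'.comp (hσ'.mono fun z hz ↦ hz.1) fun z hz ↦ hz.2
  · intro z hz
    have hz₀ : z ∈ φ₀.source := hφ₁s ▸ hz.1
    have hz1 : ψ₀.symm (φ₁ z).1 ∈ ψ.source := hz.2.1.2
    have hz2 : ((φ₁.trans σ) z).1 = ψ (ψ₀.symm (φ₁ z).1) := rfl
    rw [hz2]
    rw [hφ₁ z hz₀, ψ₀.left_inv (hψ₀ z hz₀)] at hz1 ⊢
    exact ⟨hz1, rfl⟩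

/-- Freezing the fibre coordinate gives a local section through `x`. Its composite with `f` is an
inverse chart of the base, whose differential is onto. -/
theorem mfderiv_surjective_of_isSubmersion [IsManifold (𝓡 k) ∞ M] [IsManifold (𝓡 n) ∞ B]
    (hk : k = n + r) {f : M → B} (hf : Manifold.IsSubmersion (𝓡 k) (𝓡 n) ∞ f) (x : M) :
    Function.Surjective (mfderiv (𝓡 k) (𝓡 n) f x) := by
  obtain ⟨φ, hx, -, hφ', hφf⟩ := exists_adapted_chart hk hf x
    (IsManifold.chart_mem_maximalAtlas (I := 𝓡 n) (n := ∞) (f x)) (mem_chart_source _ (f x))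
  let y : Model n := extChartAt (𝓡 n) (f x) (f x)
  have hy : y ∈ (extChartAt (𝓡 n) (f x)).target := mem_extChartAt_target (f x)
  have hfs : ContMDiff (𝓡 k) (𝓡 n) ∞ f := fun z ↦
    (isSubmersionAtOfComplement_model hk hf z).contMDiffAt
  let ι : Model n → Model n × Model r := fun a ↦ (a, (φ x).2)
  have hιx : ι y = φ x := Prod.ext (hφf x hx).2.symm rfl
  have hι : ContMDiff 𝓘(ℝ, Model n) 𝓘(ℝ, Model n × Model r) ∞ ι :=
    (contDiff_id.prodMk contDiff_const).contMDiff
  have hιy : ι y ∈ φ.target := hιx ▸ φ.map_source hx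
  have hσ : ContMDiffAt 𝓘(ℝ, Model n) (𝓡 k) ∞ (φ.symm ∘ ι) y :=
    ContMDiffAt.comp y ((hφ' (ι y) hιy).contMDiffAt (φ.open_target.mem_nhds hιy)) (hι y)
  have hσx : (φ.symm ∘ ι) y = x := by
    rw [Function.comp_apply, hιx, φ.left_inv hx]
  have hev : f ∘ (φ.symm ∘ ι) =ᶠ[𝓝 y] (extChartAt (𝓡 n) (f x)).symm := by
    filter_upwards [hι.continuous.continuousAt.preimage_mem_nhds (φ.open_target.mem_nhds hιy)]
      with a ha
    obtain ⟨h1, h2⟩ := hφf _ (φ.map_target ha)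
    rw [φ.right_inv ha] at h2
    have h3 : a = extChartAt (𝓡 n) (f x) (f (φ.symm (ι a))) := h2
    have h4 := (extChartAt (𝓡 n) (f x)).left_inv (by rw [extChartAt_source]; exact h1)
    rw [← h3] at h4
    exact h4.symm
  have hcomp := mfderiv_comp y ((hfs ((φ.symm ∘ ι) y)).mdifferentiableAt (by simp))
    (hσ.mdifferentiableAt (by simp))
  rw [hev.mfderiv_eq] at hcomp
  have hsurj : Function.Surjective (mfderiv (𝓡 k) (𝓡 n) f ((φ.symm ∘ ι) y)) := by
    intro u
    have hfy : f ((φ.symm ∘ ι) y) = (extChartAt (𝓡 n) (f x)).symm y := hev.self_of_nhds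
    obtain ⟨v, hv⟩ := chartFrame_surjective hy (show Model n from u)
    exact ⟨_, (DFunLike.congr_fun hcomp v).symm.trans hv⟩
  rwa [hσx] at hsurj

end Submersion

/-! ### Charts of the fibre product. -/

section FibreProductCharts

variable {k n r s d : ℕ} {X : Fin s → Type*} [∀ i, TopologicalSpace (X i)]
  [∀ i, ChartedSpace (Model k) (X i)] {B : Type*} [TopologicalSpace B]

/-- Charts of the factors of a fibre product in which the maps to the base are the first
projection. -/
structure AdaptedCharts (k n r : ℕ) {s : ℕ} {X : Fin s → Type*} [∀ i, TopologicalSpace (X i)]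
    [∀ i, ChartedSpace (Model k) (X i)] {B : Type*} [TopologicalSpace B] (f : ∀ i, X i → B) where
  base : OpenPartialHomeomorph B (Model n)
  chart : ∀ i, OpenPartialHomeomorph (X i) (Model n × Model r)
  smooth : ∀ i, ContMDiffOn (𝓡 k) 𝓘(ℝ, Model n × Model r) ∞ (chart i) (chart i).source
  smooth_symm : ∀ i, ContMDiffOn 𝓘(ℝ, Model n × Model r) (𝓡 k) ∞ (chart i).symm (chart i).target
  mem_base : ∀ i, ∀ x ∈ (chart i).source, f i x ∈ base.source
  fst_eq : ∀ i, ∀ x ∈ (chart i).source, (chart i x).1 = base (f i x)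

namespace AdaptedCharts

variable {f : ∀ i, X i → B} (C : AdaptedCharts k n r f)
  (L : (Model n × (Fin s → Model r)) ≃L[ℝ] Model d) (i₀ : Fin s)

/-- The coordinates of the `i`-th component of a point with given coordinates. -/
def component (L : (Model n × (Fin s → Model r)) ≃L[ℝ] Model d) (i : Fin s) :
    Model d →L[ℝ] Model n × Model r :=
  ((ContinuousLinearMap.fst ℝ _ _).prod
    ((ContinuousLinearMap.proj i).comp (ContinuousLinearMap.snd ℝ _ _))).comp
    L.symm.toContinuousLinearMap

theorem component_apply (i : Fin s) (z : Model d) :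
    component L i z = ((L.symm z).1, (L.symm z).2 i) := rfl

theorem apply_symm {i : Fin s} {q : Model n × Model r} (hq : q ∈ (C.chart i).target) :
    f i ((C.chart i).symm q) = C.base.symm q.1 := by
  have h := (C.chart i).map_target hq
  have h1 := C.fst_eq i _ h
  rw [(C.chart i).right_inv hq] at h1
  rw [h1, C.base.left_inv (C.mem_base i _ h)]

/-- The coordinates of a point of the fibre product given by adapted charts. -/
def toCoord (q : FibreProduct f) : Model d :=
  L ((C.chart i₀ (q.1 i₀)).1, fun i ↦ (C.chart i (q.1 i)).2)

open scoped Classical in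
/-- The point of the fibre product with given coordinates, with a default value `p`. -/
def ofCoord (p : FibreProduct f) (z : Model d) : FibreProduct f :=
  if h : ∀ i, component L i z ∈ (C.chart i).target then
    ⟨fun i ↦ (C.chart i).symm (component L i z), fun i j ↦
      (C.apply_symm (h i)).trans (C.apply_symm (h j)).symm⟩
  else p

/-- The base coordinates are read from the factor `i₀` only, but every component of a point has the
same image in the base, so they are those of each factor. -/
theorem component_toCoord {q : FibreProduct f} (hq : ∀ i, q.1 i ∈ (C.chart i).source)
    (i : Fin s) : component L i (C.toCoord L i₀ q) = C.chart i (q.1 i) := by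
  rw [toCoord, component_apply, L.symm_apply_apply]
  refine Prod.ext ?_ rfl
  change (C.chart i₀ (q.1 i₀)).1 = _
  rw [C.fst_eq _ _ (hq i), C.fst_eq _ _ (hq i₀), q.2 i₀ i]

theorem ofCoord_apply (p : FibreProduct f) {z : Model d}
    (hz : ∀ i, component L i z ∈ (C.chart i).target) (i : Fin s) :
    (C.ofCoord L p z).1 i = (C.chart i).symm (component L i z) := by
  rw [ofCoord, dif_pos hz]

/-- The chart of the fibre product given by adapted charts. -/
def toChart (p : FibreProduct f) : OpenPartialHomeomorph (FibreProduct f) (Model d) where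
  toFun := C.toCoord L i₀
  invFun := C.ofCoord L p
  source := {q | ∀ i, q.1 i ∈ (C.chart i).source}
  target := {z | ∀ i, component L i z ∈ (C.chart i).target}
  map_source' q hq i := by
    rw [C.component_toCoord L i₀ hq]
    exact (C.chart i).map_source (hq i)
  map_target' z hz i := by
    rw [C.ofCoord_apply L p hz]
    exact (C.chart i).map_target (hz i)
  left_inv' q hq := by
    have h' : ∀ i, component L i (C.toCoord L i₀ q) ∈ (C.chart i).target := fun i ↦
      C.component_toCoord L i₀ hq i ▸ (C.chart i).map_source (hq i)
    refine Subtype.ext (funext fun i ↦ ?_)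
    rw [C.ofCoord_apply L p h', C.component_toCoord L i₀ hq, (C.chart i).left_inv (hq i)]
  right_inv' z hz := by
    have h : ∀ i, C.chart i ((C.ofCoord L p z).1 i) = component L i z := fun i ↦ by
      rw [C.ofCoord_apply L p hz, (C.chart i).right_inv (hz i)]
    simp only [toCoord, h, component_apply]
    exact L.apply_symm_apply z
  open_source := by
    rw [Set.ofPred_forall]
    exact isOpen_iInter_of_finite fun i ↦ (C.chart i).open_source.preimage
      ((continuous_apply i).comp continuous_subtype_val)
  open_target := by
    rw [Set.ofPred_forall]
    exact isOpen_iInter_of_finite fun i ↦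
      (C.chart i).open_target.preimage (component L i).continuous
  continuousOn_toFun := by
    have h : ∀ i, ContinuousOn (fun q : FibreProduct f ↦ C.chart i (q.1 i))
        {q | ∀ i, q.1 i ∈ (C.chart i).source} := fun i ↦
      (C.chart i).continuousOn.comp ((continuous_apply i).comp continuous_subtype_val).continuousOn
        fun q hq ↦ hq i
    exact L.continuous.comp_continuousOn ((h i₀).fst.prodMk (continuousOn_pi.2 fun i ↦ (h i).snd))
  continuousOn_invFun := by
    refine Topology.IsInducing.subtypeVal.continuousOn_iff.2 (continuousOn_pi.2 fun i ↦ ?_)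
    exact ((C.chart i).continuousOn_symm.comp (component L i).continuous.continuousOn
      fun z (hz : ∀ i, component L i z ∈ (C.chart i).target) ↦ hz i).congr
        fun z hz ↦ C.ofCoord_apply L p hz i

variable {C L i₀}

theorem component_toChart {p q : FibreProduct f} (hq : q ∈ (C.toChart L i₀ p).source)
    (i : Fin s) : component L i (C.toChart L i₀ p q) = C.chart i (q.1 i) :=
  C.component_toCoord L i₀ hq i

theorem toChart_symm_apply {p : FibreProduct f} {z : Model d}
    (hz : z ∈ (C.toChart L i₀ p).target) (i : Fin s) :
    ((C.toChart L i₀ p).symm z).1 i = (C.chart i).symm (component L i z) :=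
  C.ofCoord_apply L p hz i

theorem contDiffOn_transition {C' : AdaptedCharts k n r f} {p p' : FibreProduct f} :
    ContDiffOn ℝ ∞ ((C.toChart L i₀ p).symm.trans (C'.toChart L i₀ p'))
      ((C.toChart L i₀ p).symm.trans (C'.toChart L i₀ p')).source := by
  have h : ∀ i, ContDiffOn ℝ ∞ (fun z ↦ C'.chart i (((C.toChart L i₀ p).symm z).1 i))
      ((C.toChart L i₀ p).symm.trans (C'.toChart L i₀ p')).source := by
    intro i
    have h1 : ContMDiffOn 𝓘(ℝ, Model d) 𝓘(ℝ, Model n × Model r) ∞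
        (fun z ↦ C'.chart i ((C.chart i).symm (component L i z)))
        ((C.toChart L i₀ p).symm.trans (C'.toChart L i₀ p')).source := by
      refine (C'.smooth i).comp ((C.smooth_symm i).comp
        (component L i).contDiff.contMDiff.contMDiffOn fun z hz ↦ hz.1 i) fun z hz ↦ ?_
      have h2 := toChart_symm_apply hz.1 i
      rw [Set.mem_preimage, ← h2]
      exact hz.2 i
    refine (contMDiffOn_iff_contDiffOn.1 h1).congr fun z hz ↦ ?_
    rw [toChart_symm_apply hz.1 i]
  exact L.contDiff.comp_contDiffOn ((contDiff_fst.comp_contDiffOn (h i₀)).prodMk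
    (contDiffOn_pi.2 fun i ↦ contDiff_snd.comp_contDiffOn (h i)))

end AdaptedCharts

variable [∀ i, IsManifold (𝓡 k) ∞ (X i)] [ChartedSpace (Model n) B] [IsManifold (𝓡 n) ∞ B]

/-- A fibre product of submersions is an embedded submanifold. -/
theorem exists_isSubmanifold_fibreProduct (hs : 1 ≤ s) (hk : k = n + r) (hd : d = n + s * r)
    {f : ∀ i, X i → B} (hf : ∀ i, Manifold.IsSubmersion (𝓡 k) (𝓡 n) ∞ (f i)) :
    ∃ _ : ChartedSpace (Model d) (FibreProduct f), IsManifold (𝓡 d) ∞ (FibreProduct f) ∧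
      IsSubmanifold (k := k) (d := d) f := by
  let i₀ : Fin s := ⟨0, hs⟩
  have L : (Model n × (Fin s → Model r)) ≃L[ℝ] Model d := ContinuousLinearEquiv.ofFinrankEq (by
    rw [Module.finrank_prod, Module.finrank_pi_fintype]
    simp [hd])
  have hC : ∀ p : FibreProduct f, ∃ C : AdaptedCharts k n r f,
      ∀ i, p.1 i ∈ (C.chart i).source := by
    intro p
    -- The components lie over one point of the base, so one base chart serves for all factors.
    have h : ∀ i, f i (p.1 i) ∈ (chartAt (Model n) (f i₀ (p.1 i₀))).source := fun i ↦ by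
      rw [p.2 i i₀]
      exact mem_chart_source _ _
    choose φ h1 h2 h3 h4 using fun i ↦ exists_adapted_chart hk (hf i) (p.1 i)
      (IsManifold.chart_mem_maximalAtlas (I := 𝓡 n) (n := ∞) (f i₀ (p.1 i₀))) (h i)
    exact ⟨⟨chartAt (Model n) (f i₀ (p.1 i₀)), φ, h2, h3, fun i x hx ↦ (h4 i x hx).1,
      fun i x hx ↦ (h4 i x hx).2⟩, h1⟩
  choose C hC using hC
  let cs : ChartedSpace (Model d) (FibreProduct f) :=
    { atlas := Set.range fun p ↦ (C p).toChart L i₀ p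
      chartAt := fun p ↦ (C p).toChart L i₀ p
      mem_chart_source := fun p ↦ hC p
      chart_mem_atlas := fun p ↦ ⟨p, rfl⟩ }
  have hM : IsManifold (𝓡 d) ∞ (FibreProduct f) := by
    refine isManifold_of_contDiffOn _ _ _ ?_
    rintro _ _ ⟨p, rfl⟩ ⟨p', rfl⟩
    refine AdaptedCharts.contDiffOn_transition.mono ?_
    exact fun z hz ↦ hz.1
  have hsm : ∀ i, ContMDiff (𝓡 d) (𝓡 k) ∞ (FibreProduct.proj f i) := by
    intro i p
    have h1 : ContMDiffOn (𝓡 d) (𝓡 k) ∞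
        (fun q ↦ ((C p).chart i).symm (AdaptedCharts.component L i ((C p).toChart L i₀ p q)))
        ((C p).toChart L i₀ p).source := by
      refine ((C p).smooth_symm i).comp
        ((AdaptedCharts.component L i).contDiff.contMDiff.comp_contMDiffOn
          (contMDiffOn_of_mem_maximalAtlas
            (IsManifold.chart_mem_maximalAtlas (I := 𝓡 d) (n := ∞) p)))
        fun q hq ↦ ?_
      exact ((C p).toChart L i₀ p).map_source hq i
    refine (h1.congr fun q hq ↦ ?_).contMDiffAt
      (((C p).toChart L i₀ p).open_source.mem_nhds (hC p))
    rw [AdaptedCharts.component_toChart hq, ((C p).chart i).left_inv (hq i)]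
    rfl
  refine ⟨cs, hM, hsm, fun p u hu ↦ ?_⟩
  have hpsrc : p ∈ (extChartAt (𝓡 d) p).source := mem_extChartAt_source p
  have hdc : MDifferentiableAt (𝓡 d) 𝓘(ℝ, Model d) (extChartAt (𝓡 d) p) p :=
    mdifferentiableAt_extChartAt (mem_chart_source _ p)
  have h0 : (mfderiv (𝓡 d) 𝓘(ℝ, Model d) (extChartAt (𝓡 d) p) p u : Model d) = 0 := by
    set w : Model d := mfderiv (𝓡 d) 𝓘(ℝ, Model d) (extChartAt (𝓡 d) p) p u with hw
    have hcomp : ∀ i, AdaptedCharts.component L i w = 0 := by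
      intro i
      -- The coordinates of a point are those of its components, so a vector killed by all $d\pi_i$
      -- has zero coordinates.
      have hev : (AdaptedCharts.component L i : Model d → Model n × Model r) ∘ extChartAt (𝓡 d) p
          =ᶠ[𝓝 p] (C p).chart i ∘ FibreProduct.proj f i := by
        filter_upwards [((C p).toChart L i₀ p).open_source.mem_nhds (hC p)] with q hq
        exact AdaptedCharts.component_toChart hq i
      have h1 := hev.mfderiv_eq (I := 𝓡 d) (I' := 𝓘(ℝ, Model n × Model r))
      rw [mfderiv_comp p (AdaptedCharts.component L i).mdifferentiableAt hdc,
        mfderiv_comp p ((((C p).smooth i).contMDiffAt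
          (((C p).chart i).open_source.mem_nhds (hC p i))).mdifferentiableAt (by simp))
          ((hsm i p).mdifferentiableAt (by simp))] at h1
      rw [ContinuousLinearMap.mfderiv_eq] at h1
      exact (DFunLike.congr_fun h1 u).trans ((congrArg (mfderiv (𝓡 k) 𝓘(ℝ, Model n × Model r)
        ((C p).chart i) (FibreProduct.proj f i p)) (hu i)).trans
        (ContinuousLinearMap.map_zero _))
    simp only [AdaptedCharts.component_apply, Prod.mk_eq_zero] at hcomp
    have h3 : L.symm w = 0 := Prod.ext (hcomp i₀).1 (funext fun i ↦ (hcomp i).2)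
    exact (map_eq_zero_iff L.symm L.symm.injective).1 h3
  have h4 := chartFrame_comp_mfderiv_extChartAt hpsrc u
  rw [← h4]
  exact (congrArg _ h0).trans (map_zero _)

end FibreProductCharts

/-! ### Constant multiples of forms, and distributions given as kernels. -/

section Scaling

variable {m : ℕ} {M : Type*} [TopologicalSpace M] [ChartedSpace (Model m) M]

theorem FormField.IsSmooth.const_smul {k : ℕ} {η : FormField m M k} (h : η.IsSmooth) (r : ℝ) :
    FormField.IsSmooth (r • η) := fun c ↦ (h c).const_smul r

theorem FormField.IsClosed.const_smul {k : ℕ} {η : FormField m M k} (h : η.IsClosed) (r : ℝ) :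
    FormField.IsClosed (r • η) := by
  intro c y hy
  have h1 : FormField.inChart (r • η) c = r • η.inChart c := rfl
  rw [h1, extDeriv_smul, h c y hy, smul_zero]

/-- Composing the submersion with a chart of its target gives the functions that integrability asks
for. It serves with the identity of the fibre product and with its map to the base. -/
theorem isIntegrable_of_ker [IsManifold (𝓡 m) ∞ M] {l : ℕ} {N : Type*} [TopologicalSpace N]
    [ChartedSpace (Model l) N] [IsManifold (𝓡 l) ∞ N]
    {D : ∀ x : M, Submodule ℝ (TangentSpace (𝓡 m) x)} {G : M → N}
    (hG : ContMDiff (𝓡 m) (𝓡 l) ∞ G) (hsurj : ∀ q, Function.Surjective (mfderiv (𝓡 m) (𝓡 l) G q))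
    (hD : ∀ q u, u ∈ D q ↔ mfderiv (𝓡 m) (𝓡 l) G q u = 0) : IsIntegrable D := by
  intro p
  refine ⟨G ⁻¹' (chartAt (Model l) (G p)).source, (chartAt (Model l) (G p)).open_source.preimage
    hG.continuous, mem_chart_source _ (G p), l, extChartAt (𝓡 l) (G p) ∘ G, ?_, ?_⟩
  · exact contMDiffOn_extChartAt.comp hG.contMDiffOn fun q hq ↦ hq
  · intro q hq
    have hq' : G q ∈ (extChartAt (𝓡 l) (G p)).source := by rwa [extChartAt_source]
    have hcomp := mfderiv_comp q (mdifferentiableAt_extChartAt (I := 𝓡 l) hq)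
      ((hG q).mdifferentiableAt (by simp))
    have hinv := chartFrame_comp_mfderiv_extChartAt hq'
    have happly : ∀ u, (mfderiv (𝓡 m) (𝓡 l) (extChartAt (𝓡 l) (G p) ∘ G) q u : Model l) =
        mfderiv (𝓡 l) 𝓘(ℝ, Model l) (extChartAt (𝓡 l) (G p)) (G q) (mfderiv (𝓡 m) (𝓡 l) G q u) :=
      fun u ↦ DFunLike.congr_fun hcomp u
    constructor
    · intro a
      have htgt := (extChartAt (𝓡 l) (G p)).map_source hq'
      have h1 := mfderiv_extChartAt_chartFrame htgt a
      have h2 := (extChartAt (𝓡 l) (G p)).left_inv hq'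
      obtain ⟨u, hu⟩ := hsurj q (chartFrame l (G p) (extChartAt (𝓡 l) (G p) (G q)) a)
      refine ⟨u, (happly u).trans ?_⟩
      rw [h2] at h1
      rw [hu]
      exact h1
    · ext u
      rw [hD, LinearMap.mem_ker]
      constructor
      · intro h
        refine (happly u).trans ?_
        rw [h]
        exact (mfderiv (𝓡 l) 𝓘(ℝ, Model l) (extChartAt (𝓡 l) (G p)) (G q)).map_zero
      · intro h
        have h1 := (happly u).symm.trans (h.trans (mfderiv (𝓡 l) 𝓘(ℝ, Model l)
          (extChartAt (𝓡 l) (G p)) (G q)).map_zero.symm)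
        exact (hinv _).symm.trans ((congrArg (mfderiv 𝓘(ℝ, Model l) (𝓡 l)
          (extChartAt (𝓡 l) (G p)).symm (extChartAt (𝓡 l) (G p) (G q))) h1).trans (hinv 0))

end Scaling

/-! ### The fibre product of Lagrangian fibrations. -/

section FibreProducts

variable {n s : ℕ} {X : Fin s → Type*} [∀ i, TopologicalSpace (X i)]
  [∀ i, ChartedSpace (Model (2 * n)) (X i)] [∀ i, IsManifold (𝓡 (2 * n)) ∞ (X i)]
  {B : Type*} [TopologicalSpace B] [ChartedSpace (Model n) B] [IsManifold (𝓡 n) ∞ B]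
  {g : ∀ i, Metric (2 * n) (X i)} {η : ∀ i, FormField (2 * n) (X i) 2}
  {f : ∀ i, X i → B}
  [ChartedSpace (Model (n * (s + 1))) (FibreProduct f)]
  [IsManifold (𝓡 (n * (s + 1))) ∞ (FibreProduct f)]

theorem IsLagrangianFibration.contMDiff {k m : ℕ} {M : Type*} [TopologicalSpace M]
    [ChartedSpace (Model m) M] {N : Type*} [TopologicalSpace N] [ChartedSpace (Model k) N]
    [IsManifold (𝓡 k) ∞ N] {η : FormField m M 2} {f : M → N} (hf : IsLagrangianFibration k η f) :
    ContMDiff (𝓡 m) (𝓡 k) ∞ f := by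
  obtain ⟨F, _, _, hF⟩ := hf.submersion
  exact fun x ↦ (hF x).contMDiffAt

theorem IsLagrangianFibration.mfderiv_surjective {M : Type*} [TopologicalSpace M]
    [ChartedSpace (Model (2 * n)) M] [IsManifold (𝓡 (2 * n)) ∞ M]
    {η : FormField (2 * n) M 2} {f : M → B} (hf : IsLagrangianFibration n η f) (x : M) :
    Function.Surjective (mfderiv (𝓡 (2 * n)) (𝓡 n) f x) :=
  mfderiv_surjective_of_isSubmersion (by ring) hf.submersion x

theorem mfderiv_proj_compatible (hf : ∀ i, IsLagrangianFibration n (η i) (f i))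
    (hS : IsSubmanifold (k := 2 * n) (d := n * (s + 1)) f) (i₀ i : Fin s) (p : FibreProduct f)
    (u : Model (n * (s + 1))) :
    (mfderiv (𝓡 (2 * n)) (𝓡 n) (f i) (FibreProduct.proj f i p)
      (mfderiv (𝓡 (n * (s + 1))) (𝓡 (2 * n)) (FibreProduct.proj f i) p u) : Model n) =
    mfderiv (𝓡 (n * (s + 1))) (𝓡 n) (f i₀ ∘ FibreProduct.proj f i₀) p u := by
  have h : f i ∘ FibreProduct.proj f i = f i₀ ∘ FibreProduct.proj f i₀ :=
    funext fun q ↦ q.2 i i₀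
  have h1 := mfderiv_comp p (((hf i).contMDiff (FibreProduct.proj f i p)).mdifferentiableAt
    (by simp)) ((hS.smooth i p).mdifferentiableAt (by simp))
  rw [h] at h1
  exact (DFunLike.congr_fun h1 u).symm

theorem exists_mfderiv_proj_eq (hs : 1 ≤ s) (hf : ∀ i, IsLagrangianFibration n (η i) (f i))
    (hS : IsSubmanifold (k := 2 * n) (d := n * (s + 1)) f) (p : FibreProduct f)
    (S : ∀ i, TangentSpace (𝓡 (2 * n)) (FibreProduct.proj f i p)) (a : Model n)
    (hSa : ∀ i, (mfderiv (𝓡 (2 * n)) (𝓡 n) (f i) (FibreProduct.proj f i p) (S i) : Model n) = a) :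
    ∃ w : TangentSpace (𝓡 (n * (s + 1))) p,
      ∀ i, mfderiv (𝓡 (n * (s + 1))) (𝓡 (2 * n)) (FibreProduct.proj f i) p w = S i :=
  exists_common_lift (T := Model (n * (s + 1))) (W := Model n) (V := fun _ ↦ Model (2 * n)) hs
    finrank_euclideanSpace_fin finrank_euclideanSpace_fin (fun _ ↦ finrank_euclideanSpace_fin)
    (fun i ↦ (mfderiv (𝓡 (n * (s + 1))) (𝓡 (2 * n)) (FibreProduct.proj f i) p).toLinearMap)
    (fun i ↦ (mfderiv (𝓡 (2 * n)) (𝓡 n) (f i) (FibreProduct.proj f i p)).toLinearMap)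
    (hS.immersive p) (fun i ↦ (hf i).mfderiv_surjective _)
    (fun i j t ↦ (mfderiv_proj_compatible hf hS j i p t).trans
      (mfderiv_proj_compatible hf hS j j p t).symm) S a hSa

/-- A vector in slot $j$ is completed to a tangent vector of $X$ by arbitrary lifts of its base
image in the other slots, which exist because the $f_i$ are submersions. -/
theorem mfderiv_proj_surjective (hs : 1 ≤ s) (hf : ∀ i, IsLagrangianFibration n (η i) (f i))
    (hS : IsSubmanifold (k := 2 * n) (d := n * (s + 1)) f) (p : FibreProduct f) (j : Fin s) :
    Function.Surjective
      (mfderiv (𝓡 (n * (s + 1))) (𝓡 (2 * n)) (FibreProduct.proj f j) p) := by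
  intro v
  let a : Model n := mfderiv (𝓡 (2 * n)) (𝓡 n) (f j) (FibreProduct.proj f j p) v
  choose S hS' using fun i ↦ (hf i).mfderiv_surjective (FibreProduct.proj f i p) a
  obtain ⟨w, hw⟩ := exists_mfderiv_proj_eq hs hf hS p (Function.update S j v) a fun i ↦ by
    by_cases hij : i = j
    · subst hij
      rw [Function.update_self]
    · rw [Function.update_of_ne hij]
      exact hS' i
  exact ⟨w, (hw j).trans (Function.update_self ..)⟩

/-- Since $d\pi_j$ is onto, a vector $u$ of $\omega_j^\perp$ can be tested against some $v$ with
$d\pi_j v = J\,d\pi_j u$. This gives $g(d\pi_j u, d\pi_j u) = 0$. -/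
theorem mem_perp_smul_pullback_iff (hs : 1 ≤ s) (hK : ∀ i, IsAlmostKahler (g i) (η i))
    (hf : ∀ i, IsLagrangianFibration n (η i) (f i))
    (hS : IsSubmanifold (k := 2 * n) (d := n * (s + 1)) f) (p : FibreProduct f) (j : Fin s)
    (u : TangentSpace (𝓡 (n * (s + 1))) p) :
    u ∈ FormField.perp (√(s : ℝ) • (η j).pullback (m := n * (s + 1)) (FibreProduct.proj f j)) p ↔
      mfderiv (𝓡 (n * (s + 1))) (𝓡 (2 * n)) (FibreProduct.proj f j) p u = 0 := by
  let P : Model (n * (s + 1)) →L[ℝ] Model (2 * n) :=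
    mfderiv (𝓡 (n * (s + 1))) (𝓡 (2 * n)) (FibreProduct.proj f j) p
  let τ : Model (2 * n) [⋀^Fin 2]→L[ℝ] ℝ := η j (FibreProduct.proj f j p)
  have hs0 : √(s : ℝ) ≠ 0 := (Real.sqrt_pos.2 (by exact_mod_cast hs)).ne'
  have hval : ∀ v : Model (n * (s + 1)),
      (√(s : ℝ) • (η j).pullback (m := n * (s + 1)) (FibreProduct.proj f j)) p ![u, v] =
      √(s : ℝ) * alternatingBilin τ (P u) (P v) := by
    intro v
    rw [alternatingBilin_apply]
    change √(s : ℝ) * τ (P ∘ ![u, v]) = _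
    congr 2
    ext i; fin_cases i <;> rfl
  change (∀ v : Model (n * (s + 1)), _) ↔ P u = 0
  constructor
  · intro h
    obtain ⟨J, hJ, hg⟩ := (hK j).compatible (FibreProduct.proj f j p)
    obtain ⟨v, hv⟩ := mfderiv_proj_surjective hs hf hS p j (J (P u))
    have h1 := (hval v).symm.trans (h v)
    have h2 : P v = J (P u) := hv
    rw [h2, mul_eq_zero, or_iff_right hs0] at h1
    by_contra hne
    exact ((g j).pos (FibreProduct.proj f j p) (P u) hne).ne' ((hg (P u) (P u)).trans h1)
  · intro h v
    refine (hval v).trans ?_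
    rw [h, map_zero, LinearMap.zero_apply, mul_zero]

theorem isIntegrable_fibreProduct (hs : 1 ≤ s) (hK : ∀ i, IsAlmostKahler (g i) (η i))
    (hf : ∀ i, IsLagrangianFibration n (η i) (f i))
    (hS : IsSubmanifold (k := 2 * n) (d := n * (s + 1)) f) :
    IsIntegrable fun p ↦ ⨆ j, FormField.perp
      (√(s : ℝ) • (η j).pullback (m := n * (s + 1)) (FibreProduct.proj f j)) p := by
  let i₀ : Fin s := ⟨0, hs⟩
  have hperp := mem_perp_smul_pullback_iff hs hK hf hS
  -- For a single factor the distribution is zero, not the kernel of the map to the base: the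
  -- decomposition used for $s \ge 2$ needs a second index.
  by_cases hs1 : s = 1
  · refine isIntegrable_of_ker (G := (id : FibreProduct f → FibreProduct f)) contMDiff_id
      (fun q ↦ ?_) fun q u ↦ ?_
    · rw [mfderiv_id]
      exact Function.surjective_id
    · rw [mfderiv_id]
      have hall : ∀ j : Fin s, j = i₀ := fun j ↦ Fin.ext (by have := j.2; simp [i₀]; omega)
      have hbot : ∀ j, FormField.perp
          (√(s : ℝ) • (η j).pullback (m := n * (s + 1)) (FibreProduct.proj f j)) q = ⊥ := by
        intro j
        refine (Submodule.eq_bot_iff _).2 fun v hv ↦ hS.immersive q v fun i ↦ ?_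
        rw [hall i, ← hall j]
        exact (hperp q j v).1 hv
      simp only [hbot, iSup_bot, Submodule.mem_bot]
      rfl
  · have hcompat := fun i ↦ mfderiv_proj_compatible hf hS i₀ i
    refine isIntegrable_of_ker (G := f i₀ ∘ FibreProduct.proj f i₀)
      ((hf i₀).contMDiff.comp (hS.smooth i₀)) (fun q a ↦ ?_) fun q u ↦ ⟨fun hu ↦ ?_, fun hu ↦ ?_⟩
    · obtain ⟨v, hv⟩ := (hf i₀).mfderiv_surjective (FibreProduct.proj f i₀ q) a
      obtain ⟨u, rfl⟩ := mfderiv_proj_surjective hs hf hS q i₀ v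
      exact ⟨u, (hcompat i₀ q u).symm.trans hv⟩
    · have hle : (⨆ j, FormField.perp
          (√(s : ℝ) • (η j).pullback (m := n * (s + 1)) (FibreProduct.proj f j)) q) ≤
          LinearMap.ker (mfderiv (𝓡 (n * (s + 1))) (𝓡 n)
            (f i₀ ∘ FibreProduct.proj f i₀) q).toLinearMap := by
        refine iSup_le fun j v hv ↦ ?_
        rw [LinearMap.mem_ker]
        refine (hcompat j q v).symm.trans ?_
        rw [(hperp q j v).1 hv]
        exact ContinuousLinearMap.map_zero _
      exact hle hu
    · let P : ∀ i, Model (n * (s + 1)) →L[ℝ] Model (2 * n) := fun i ↦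
        mfderiv (𝓡 (n * (s + 1))) (𝓡 (2 * n)) (FibreProduct.proj f i) q
      let u' : Model (n * (s + 1)) := u
      -- A vector vertical over the base is the sum of its single-slot parts. The part in slot $j$
      -- is killed by $d\pi_{j'}$ for any $j' \ne j$ and so lies in $\omega_{j'}^\perp$.
      have hlift : ∀ j, ∃ w : Model (n * (s + 1)), ∀ i, P i w = if i = j then P i u' else 0 := by
        intro j
        refine exists_mfderiv_proj_eq hs hf hS q (fun i ↦ if i = j then P i u' else 0) 0 fun i ↦ ?_
        let A : Model (2 * n) →L[ℝ] Model n :=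
          mfderiv (𝓡 (2 * n)) (𝓡 n) (f i) (FibreProduct.proj f i q)
        change A (if i = j then P i u' else 0) = 0
        by_cases hij : i = j
        · rw [if_pos hij]
          exact (hcompat i q u).trans hu
        · rw [if_neg hij, map_zero]
      choose w hw using hlift
      have hsum : ∑ j, w j = u' := by
        refine sub_eq_zero.1 (hS.immersive q _ fun i ↦ ?_)
        change P i (∑ j, w j - u') = 0
        rw [map_sub, map_sum]
        simp [hw]
      let w' : Fin s → TangentSpace (𝓡 (n * (s + 1))) q := w
      have hsum' : ∑ j, w' j = u := hsum
      rw [← hsum']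
      refine Submodule.sum_mem _ fun j _ ↦ ?_
      obtain ⟨j', hj'⟩ : ∃ j' : Fin s, j' ≠ j := by
        have : Nontrivial (Fin s) := Fin.nontrivial_iff_two_le.2 (by omega)
        exact exists_ne j
      refine Submodule.mem_iSup_of_mem j' ((hperp q j' (w j)).2 ?_)
      exact (hw j j').trans (if_neg hj')

theorem exists_isStandardBasis_tangent (hs : 1 ≤ s) (hK : ∀ i, IsAlmostKahler (g i) (η i))
    (hf : ∀ i, IsLagrangianFibration n (η i) (f i))
    (hS : IsSubmanifold (k := 2 * n) (d := n * (s + 1)) f) (p : FibreProduct f)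
    (e : Module.Basis (Fin n) ℝ (Model n)) :
    ∃ b : Module.Basis (Fin n ⊕ Fin s × Fin n) ℝ (TangentSpace (𝓡 (n * (s + 1))) p),
      IsStandardBasis (fun j ↦
        (√(s : ℝ) • (η j).pullback (m := n * (s + 1)) (FibreProduct.proj f j)) p) b ∧
      ((∀ i (u v : Model (2 * n)) k l,
          (∀ w, mfderiv (𝓡 (2 * n)) (𝓡 n) (f i) (FibreProduct.proj f i p) w = 0 →
            (g i).inner (FibreProduct.proj f i p) u w = 0) →
          (∀ w, mfderiv (𝓡 (2 * n)) (𝓡 n) (f i) (FibreProduct.proj f i p) w = 0 →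
            (g i).inner (FibreProduct.proj f i p) v w = 0) →
          (mfderiv (𝓡 (2 * n)) (𝓡 n) (f i) (FibreProduct.proj f i p) u : Model n) = e k →
          (mfderiv (𝓡 (2 * n)) (𝓡 n) (f i) (FibreProduct.proj f i p) v : Model n) = e l →
          (g i).inner (FibreProduct.proj f i p) u v = if k = l then 1 else 0) →
        ∀ a a', ∑ i, (g i).inner (FibreProduct.proj f i p)
          (mfderiv (𝓡 (n * (s + 1))) (𝓡 (2 * n)) (FibreProduct.proj f i) p (b a))
          (mfderiv (𝓡 (n * (s + 1))) (𝓡 (2 * n)) (FibreProduct.proj f i) p (b a')) =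
          if a = a' then 1 else 0) := by
  choose J hJ hg using fun i ↦ (hK i).compatible (FibreProduct.proj f i p)
  exact exists_isStandardBasis_fibreProduct (V := Model (n * (s + 1))) (W := Model n)
    (E := fun _ ↦ Model (2 * n)) hs finrank_euclideanSpace_fin
    (fun _ ↦ finrank_euclideanSpace_fin) e (fun i ↦ η i (FibreProduct.proj f i p))
    (fun i ↦ J i) (fun i ↦ (g i).inner (FibreProduct.proj f i p))
    (fun u v ↦ ∑ i, (g i).inner (FibreProduct.proj f i p)
      (mfderiv (𝓡 (n * (s + 1))) (𝓡 (2 * n)) (FibreProduct.proj f i) p u)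
      (mfderiv (𝓡 (n * (s + 1))) (𝓡 (2 * n)) (FibreProduct.proj f i) p v))
    (fun i ↦ (g i).symm _) (fun i ↦ (g i).pos _) hJ hg
    (fun i ↦ mfderiv (𝓡 (2 * n)) (𝓡 n) (f i) (FibreProduct.proj f i p))
    (fun i ↦ (hf i).mfderiv_surjective _)
    (fun i u v hu hv ↦ ((hf i).lagrangian (FibreProduct.proj f i p) u).1 hu v hv)
    (fun i ↦ mfderiv (𝓡 (n * (s + 1))) (𝓡 (2 * n)) (FibreProduct.proj f i) p)
    (hS.immersive p)
    (fun i j t ↦ (mfderiv_proj_compatible hf hS j i p t).trans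
      (mfderiv_proj_compatible hf hS j j p t).symm) (fun _ _ ↦ rfl)

theorem isPolysymplectic_fibreProduct (hs : 1 ≤ s) (hK : ∀ i, IsAlmostKahler (g i) (η i))
    (hf : ∀ i, IsLagrangianFibration n (η i) (f i))
    (hS : IsSubmanifold (k := 2 * n) (d := n * (s + 1)) f) :
    IsPolysymplectic n fun j ↦
      √(s : ℝ) • (η j).pullback (m := n * (s + 1)) (FibreProduct.proj f j) where
  smooth j := ((hK j).smooth.pullback (hS.smooth j)).const_smul _
  closed j := ((hK j).closed.pullback (hK j).smooth (hS.smooth j)).const_smul _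
  pointwise p := by
    obtain ⟨b, hb, -⟩ := exists_isStandardBasis_tangent hs hK hf hS p
      (EuclideanSpace.basisFun (Fin n) ℝ).toBasis
    exact ⟨b, hb⟩
  integrable := isIntegrable_fibreProduct hs hK hf hS

/-- All components of `p` lie over one point, so a single frame orthonormal for `h` there can be
lifted in every factor. The Riemannian condition makes each horizontal lift orthonormal, which is
where a common metric on the base is used. -/
theorem isCompatible_fibreProduct (hs : 1 ≤ s) (hK : ∀ i, IsAlmostKahler (g i) (η i))
    (hf : ∀ i, IsLagrangianFibration n (η i) (f i))
    (hS : IsSubmanifold (k := 2 * n) (d := n * (s + 1)) f)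
    {gX : Metric (n * (s + 1)) (FibreProduct f)}
    (hgX : ∀ p u v, gX.inner p u v = ∑ i, (g i).inner (FibreProduct.proj f i p)
      (mfderiv (𝓡 (n * (s + 1))) (𝓡 (2 * n)) (FibreProduct.proj f i) p u)
      (mfderiv (𝓡 (n * (s + 1))) (𝓡 (2 * n)) (FibreProduct.proj f i) p v))
    {h : Metric n B} (hR : ∀ i, IsRiemannian (g i) h (f i)) :
    IsCompatible n gX fun j ↦
      √(s : ℝ) • (η j).pullback (m := n * (s + 1)) (FibreProduct.proj f j) := by
  intro p
  let i₀ : Fin s := ⟨0, hs⟩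
  let x := f i₀ (FibreProduct.proj f i₀ p)
  let H : Model n →L[ℝ] Model n →L[ℝ] ℝ := h.inner x
  obtain ⟨e, he⟩ := exists_orthonormal_basis_of_pos (W := Model n) finrank_euclideanSpace_fin
    ((ContinuousLinearMap.coeLM ℝ).comp H.toLinearMap) (h.symm x) (h.pos x)
  obtain ⟨b, hb, hb'⟩ := exists_isStandardBasis_tangent hs hK hf hS p e
  refine ⟨b, hb, fun a a' ↦ (hgX p _ _).trans (hb' ?_ a a')⟩
  intro i u v k l hu hv huk hvl
  rw [← hR i _ u v hu hv, ← he k l]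
  refine (bilin_apply_of_eq h.inner (p.2 i i₀) _ _).trans ?_
  change H _ _ = H (e k) (e l)
  rw [← huk, ← hvl]

end FibreProducts
end PolyK

end

/-- After existence, the claims are proved for every smooth structure that makes the fibre product
an embedded submanifold, not only for the one constructed. The induced metric is chosen before any
metric on the base. -/
theorem mainTheorem3 {n s : ℕ} (hs : 1 ≤ s)
    {X : Fin s → Type*} [∀ i, TopologicalSpace (X i)]
    [∀ i, ChartedSpace (Model (2 * n)) (X i)] [∀ i, IsManifold (𝓡 (2 * n)) ∞ (X i)]
    {B : Type*} [TopologicalSpace B] [ChartedSpace (Model n) B] [IsManifold (𝓡 n) ∞ B]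
    (g : ∀ i, Metric (2 * n) (X i)) (η : ∀ i, FormField (2 * n) (X i) 2)
    (hK : ∀ i, IsAlmostKahler (g i) (η i))
    (f : ∀ i, X i → B) (hf : ∀ i, IsLagrangianFibration n (η i) (f i)) :
    (∃ _ : ChartedSpace (Model (n * (s + 1))) (FibreProduct f),
      IsManifold (𝓡 (n * (s + 1))) ∞ (FibreProduct f) ∧
      IsSubmanifold (k := 2 * n) (d := n * (s + 1)) f) ∧
    ∀ [ChartedSpace (Model (n * (s + 1))) (FibreProduct f)]
      [IsManifold (𝓡 (n * (s + 1))) ∞ (FibreProduct f)],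
      IsSubmanifold (k := 2 * n) (d := n * (s + 1)) f →
      let Ω : Fin s → FormField (n * (s + 1)) (FibreProduct f) 2 := fun j ↦
        √(s : ℝ) • (η j).pullback (FibreProduct.proj f j)
      IsPolysymplectic n Ω ∧
      ∃ gX : Metric (n * (s + 1)) (FibreProduct f),
        (∀ p u v, gX.inner p u v = ∑ i, (g i).inner (FibreProduct.proj f i p)
          (mfderiv (𝓡 (n * (s + 1))) (𝓡 (2 * n)) (FibreProduct.proj f i) p u)
          (mfderiv (𝓡 (n * (s + 1))) (𝓡 (2 * n)) (FibreProduct.proj f i) p v)) ∧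
        ∀ h : Metric n B, (∀ i, IsRiemannian (g i) h (f i)) →
          IsAlmostSKahler n gX Ω ∧
          ((∀ i, IsParallelForm (g i) (η i)) → (∀ i, IsCovariantConstant (g i) h (f i)) →
            ∀ j, IsParallelForm gX (Ω j)) := by
  have hsub : ∀ i, Manifold.IsSubmersion (𝓡 (2 * n)) (𝓡 n) ∞ (f i) := fun i ↦ (hf i).submersion
  refine ⟨exists_isSubmanifold_fibreProduct (r := n) hs (by ring) (by ring) hsub, ?_⟩
  intro _ _ hS Ω
  have hpoly : IsPolysymplectic n Ω := isPolysymplectic_fibreProduct hs hK hf hS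
  have hgX := inducedMetric_inner g (FibreProduct.proj f) hS.smooth hS.immersive
  refine ⟨hpoly, inducedMetric g (FibreProduct.proj f) hS.smooth hS.immersive, hgX,
    fun h hR ↦ ⟨⟨hpoly, isCompatible_fibreProduct hs hK hf hS hgX hR⟩, fun hpar hcov j ↦ ?_⟩⟩
  exact (hpar j).smul_pullback (hK j).smooth (hS.smooth j) (fun c y hy u v ↦
    christoffelDefect_fibreProduct (F := f ⟨0, hs⟩ ∘ FibreProduct.proj f ⟨0, hs⟩) hS.smooth
      (fun i ↦ (hf i).contMDiff) (fun i x ↦ x.2 i ⟨0, hs⟩) hgX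
      (exists_mfderiv_proj_eq hs hf hS) hcov c hy u v j) _
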